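/- **Theorem 2.** Let $L^2(\Omega)$ be the space of real- or complex-valued square-integrable functions on a measure space $\Omega$ (for instance a domain in $\mathbb R^n$), let $h>0$, and let $C=C([-h,0];L^2(\Omega))$ with the maximum norm. Assume: (i) $A$ is a linear operator with domain $D(A)\subset L^2(\Omega)$ such that $-A$ is the infinitesimal generator of a $C_0$-semigroup $\{e^{-At}\}_{t\ge0}$ on $L^2(\Omega)$ that is compact (every $e^{-At}$, $t>0$, is a compact operator) and analytic (it, or its complexification in the real case, extends to an analytic semigroup in a sector of $\mathbb C$ around the positive half-axis); (ii) $F:C\to L^2(\Omega)$ has the form $F(\psi)=B\bigl(\psi(-r(\psi))\bigr)$, where $B:L^2(\Omega)\to L^2(\Omega)$ is a (nonlinear) Lipschitz map that maps bounded sets to bounded sets, and $r:C\to[0,h]$ is Lipschitz. For a function $u$ that is continuous on $[-h,T)$ and $t\in[0,T)$ let $u_t\in C$ be given by $u_t(\theta)=u(t+\theta)$, $\theta\in[-h,0]$. Then for every $\varphi\in C^1([-h,0];L^2(\Omega))$ with $\varphi(0)\in D(A)$ there is $t_\varphi>0$ such that the initial value problem $$\frac{du(t)}{dt}+Au(t)=F(u_t),\quad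 t>0,\qquad u|_{[-h,0]}=\varphi,$$ has a unique classical solution on $[-h,t_\varphi)$, that is, there is exactly one function $u\in C([-h,t_\varphi);L^2(\Omega))\cap C^1((0,t_\varphi);L^2(\Omega))$ with $u|_{[-h,0]}=\varphi$, such that for all $0<t<t_\varphi$ one has $u(t)\in D(A)$ and the equation holds at $t$. -/

import Mathlib

open Set Filter Topology MeasureTheory

noncomputable section

/-! ### Semigroups of operators -/

section Semigroups

variable {𝕜 : Type*} [RCLike 𝕜] {E : Type*} [NormedAddCommGroup E] [NormedSpace 𝕜 E]

/-- `(S t)`, `t ≥ 0`, is a strongly continuous (`C₀`) semigroup of bounded linear operators.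
Only the values of `S` on `[0, ∞)` matter. -/
structure IsC0Semigroup (S : ℝ → E →L[𝕜] E) : Prop where
  map_zero : S 0 = ContinuousLinearMap.id 𝕜 E
  map_add : ∀ s t : ℝ, 0 ≤ s → 0 ≤ t → S (s + t) = (S s).comp (S t)
  tendsto_zero : ∀ x : E, Tendsto (fun t : ℝ => S t x) (𝓝[>] 0) (𝓝 x)

/-- The semigroup is compact: `S t` is a compact operator for every `t > 0`. -/
def IsCompactSemigroup (S : ℝ → E →L[𝕜] E) : Prop :=
  ∀ t : ℝ, 0 < t → IsCompactOperator (S t)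

/-- The linear operator `G`, with domain `G.domain`, is the infinitesimal generator of `S`:
`x ∈ D(G)` and `G x = y` if and only if `(S t x - x) / t → y` as `t → 0+`. -/
def IsInfinitesimalGenerator (G : E →ₗ.[𝕜] E) (S : ℝ → E →L[𝕜] E) : Prop :=
  ∀ x y : E, (∃ hx : x ∈ G.domain, G ⟨x, hx⟩ = y) ↔
    Tendsto (fun t : ℝ => ((t⁻¹ : ℝ) : 𝕜) • (S t x - x)) (𝓝[>] 0) (𝓝 y)

end Semigroups

/-- The open sector `{z ≠ 0 : |arg z| < θ}` in the complex plane. -/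
def openSector (θ : ℝ) : Set ℂ := {z | z ≠ 0 ∧ |Complex.arg z| < θ}

section L2

variable {𝕜 : Type*} [RCLike 𝕜] {Ω : Type*} [MeasurableSpace Ω] {μ : Measure Ω}

/-- The canonical map `L²(Ω; 𝕜) → L²(Ω; ℂ)`: for `𝕜 = ℝ` the inclusion of real-valued functions
into complex-valued ones, for `𝕜 = ℂ` the identity. -/
def toComplexL2 (f : Lp 𝕜 2 μ) : Lp ℂ 2 μ := (RCLike.map 𝕜 ℂ).compLp f

/-- The semigroup `S` on `L²(Ω; 𝕜)` is analytic: it (for `𝕜 = ℝ`, its complexification on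
`L²(Ω; ℂ)`) extends to a family `Z z` of bounded linear operators on a sector around the positive
real axis, which is holomorphic in the sector, satisfies the semigroup law, and converges strongly
to the identity as `z → 0` in the sector. -/
def IsAnalyticSemigroup (S : ℝ → Lp 𝕜 2 μ →L[𝕜] Lp 𝕜 2 μ) : Prop :=
  ∃ θ : ℝ, 0 < θ ∧ θ ≤ Real.pi / 2 ∧ ∃ Z : ℂ → Lp ℂ 2 μ →L[ℂ] Lp ℂ 2 μ,
    (∀ t : ℝ, 0 < t → ∀ f : Lp 𝕜 2 μ, Z (t : ℂ) (toComplexL2 f) = toComplexL2 (S t f)) ∧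
    DifferentiableOn ℂ Z (openSector θ) ∧
    (∀ z ∈ openSector θ, ∀ w ∈ openSector θ, Z (z + w) = (Z z).comp (Z w)) ∧
    ∀ f : Lp ℂ 2 μ, Tendsto (fun z => Z z f) (𝓝[openSector θ] 0) (𝓝 f)

/-- The operator `A` gives rise to a compact analytic `C₀`-semigroup `S t = e^{-A t}`, that is,
`-A` is the infinitesimal generator of such a semigroup. -/
def GeneratesCompactAnalyticSemigroup (A : Lp 𝕜 2 μ →ₗ.[𝕜] Lp 𝕜 2 μ) : Prop :=
  ∃ S : ℝ → Lp 𝕜 2 μ →L[𝕜] Lp 𝕜 2 μ,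
    IsC0Semigroup S ∧ IsCompactSemigroup S ∧ IsAnalyticSemigroup S ∧
      IsInfinitesimalGenerator (-A) S

end L2

/-! ### Equations with a discrete state-dependent delay -/

section Delay

variable {E : Type*} [NormedAddCommGroup E]

/-- The phase space `C = C([-h, 0]; E)` with the maximum norm. -/
abbrev HistorySpace (h : ℝ) (E : Type*) [NormedAddCommGroup E] : Type _ := C(Icc (-h) (0 : ℝ), E)

/-- The point `-s ∈ [-h, 0]` for `s ∈ [0, h]`. -/
def negDelay {h : ℝ} (s : Icc (0 : ℝ) h) : Icc (-h) (0 : ℝ) :=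
  ⟨-(s : ℝ), neg_le_neg s.2.2, neg_nonpos.2 s.2.1⟩

/-- The delay term `F(ψ) = B (ψ (-r(ψ)))`. -/
def delayTerm {h : ℝ} (B : E → E) (r : HistorySpace h E → Icc (0 : ℝ) h)
    (ψ : HistorySpace h E) : E :=
  B (ψ (negDelay (r ψ)))

/-- The history `u_t ∈ C([-h, 0]; E)`, `u_t(θ) = u(t + θ)`, for `t ∈ [0, T)`, of a function `u`
that is continuous on `[-h, T)`. -/
def history {h T : ℝ} {u : ℝ → E} (hu : ContinuousOn u (Ico (-h) T)) {t : ℝ}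
    (ht : t ∈ Ico 0 T) : HistorySpace h E where
  toFun θ := u (t + (θ : ℝ))
  continuous_toFun :=
    hu.comp_continuous (continuous_const.add continuous_subtype_val) fun θ =>
      ⟨by linarith [θ.2.1, ht.1], by linarith [θ.2.2, ht.2]⟩

variable {𝕜 : Type*} [RCLike 𝕜] [NormedSpace 𝕜 E] [NormedSpace ℝ E]

/-- `u` (that is, its restriction to `[-h, T)`) is a classical solution on `[-h, T)` of
`u'(t) + A u(t) = F(u_t)`, `u₀ = φ`, where `φ` is a function on `[-h, 0]`. -/
structure IsClassicalSolution (A : E →ₗ.[𝕜] E) {h : ℝ} (F : HistorySpace h E → E)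
    (φ : ℝ → E) (T : ℝ) (u : ℝ → E) : Prop where
  continuousOn : ContinuousOn u (Ico (-h) T)
  contDiffOn : ContDiffOn ℝ 1 u (Ioo 0 T)
  initial : EqOn u φ (Icc (-h) 0)
  mem_domain : ∀ t ∈ Ioo 0 T, u t ∈ A.domain
  equation : ∀ (t : ℝ) (ht : t ∈ Ioo 0 T),
    deriv u t + A ⟨u t, mem_domain t ht⟩ = F (history continuousOn (Ioo_subset_Ico_self ht))

end Delay

end

/-!
The delay term `F(ψ) = B(ψ(-r(ψ)))` is not Lipschitz on the phase space, but
`‖F(ψ₁) - F(ψ₂)‖ ≤ L_B (K L_r + 1) ‖ψ₁ - ψ₂‖` as soon as one of the two histories is `K`-Lipschitz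
(`norm_delayTerm_sub_le`). So the integral equation
`u(t) = R(t) φ(0) + ∫₀ᵗ R(t - s) F(u_s) ds` is solved in a complete space of `K`-Lipschitz functions
with prescribed history. Since `φ` is Lipschitz and `φ(0) ∈ D(A)`, the free part of the right-hand
side is Lipschitz; the Lipschitz constant of the integral is controlled by the size of the source
and by `T` times its Lipschitz constant. For a suitable `K` and small `T` the right-hand side is
therefore a contraction of this space (`exists_isMildSolution`).

The source term `f(t) = F(u_t)` of this solution is Lipschitz, and analyticity turns the mild
solution into a classical one. The Cauchy estimate in discs of radius proportional to `σ` gives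
`‖(d/dσ) R(σ)‖ ≤ C / σ` (`exists_norm_deriv_le_of_sector`), so that
`∫₀ᵗ (d/dσ) R(σ) (f(t - σ) - f(t)) dσ` has a bounded integrand. By dominated convergence, this
integral plus `R(t) f(t)` is the right derivative of the convolution and is continuous in `t`, which
makes it the derivative (`hasDerivAt_mild`). In the real case the estimate is obtained on the
complexification and transferred along the isometry `toComplexL2`.

Conversely every classical solution `v` is mild, since `s ↦ R(t - s) v(s)` has the right derivative
`R(t - s) F(v_s)` (`eq_mild_of_hasDerivAt`). As the solution constructed above is Lipschitz, the
estimate for `F` applies to the pair of solutions although nothing is known about the Lipschitz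
continuity of `v`, and for small `T` the maximum of the difference vanishes
(`eq_of_isMildSolution`).
-/

noncomputable section

/-! ### Semigroups on a short time interval -/

section LocalSemigroup

variable {E : Type*} [NormedAddCommGroup E] [NormedSpace ℝ E]

/-- A bounded, strongly continuous operator semigroup on the time interval `[0, δ]`, extended to
all of `ℝ` by its values at the endpoints, that has the two features of analytic semigroups needed
below: orbits are differentiable at positive times, and their increments obey the bound
`C η / σ` that results from `‖(d/dσ) R σ‖ ≤ C / σ`. Extending `R` to `ℝ` makes the integrands below
continuous everywhere. -/
structure LocalAnalyticSemigroup (R : ℝ → E →L[ℝ] E) (δ M C : ℝ) : Prop where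
  delta_pos : 0 < δ
  eq_of_nonpos : ∀ t ≤ 0, ∀ x, R t x = x
  map_add : ∀ s t, 0 ≤ s → 0 ≤ t → s + t ≤ δ → ∀ x, R (s + t) x = R s (R t x)
  continuous : ∀ x, Continuous fun t => R t x
  norm_le : ∀ t, ‖R t‖ ≤ M
  norm_sub_le : ∀ σ η, 0 < σ → 0 ≤ η → σ + η ≤ δ → ∀ x, ‖R (σ + η) x - R σ x‖ ≤ C * η / σ * ‖x‖
  differentiableAt : ∀ σ, 0 < σ → σ < δ → ∀ x, DifferentiableAt ℝ (fun t => R t x) σ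

/-- `y` is the value at `x` of the infinitesimal generator of `R`. -/
def HasGeneratorValue (R : ℝ → E →L[ℝ] E) (x y : E) : Prop :=
  Tendsto (fun η : ℝ => η⁻¹ • (R η x - x)) (𝓝[>] 0) (𝓝 y)

theorem hasDerivWithinAt_Ioi_iff_tendsto {f : ℝ → E} {f' : E} {x : ℝ} :
    HasDerivWithinAt f f' (Ioi x) x ↔
      Tendsto (fun η : ℝ => η⁻¹ • (f (x + η) - f x)) (𝓝[>] 0) (𝓝 f') := by
  have hm : 𝓝[>] x = Filter.map (fun η => x + η) (𝓝[>] 0) := by simp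
  rw [hasDerivWithinAt_iff_tendsto_slope' (by simp), hm, tendsto_map'_iff]
  simp [slope, Function.comp_def]

/-- A continuous function whose right derivative is continuous is differentiable, the two-sided
derivative being the given right derivative. -/
theorem hasDerivAt_of_continuousOn_right_deriv [CompleteSpace E] {f g : ℝ → E} {a b : ℝ}
    (hf : ContinuousOn f (Ioo a b)) (hg : ContinuousOn g (Ioo a b))
    (h : ∀ t ∈ Ioo a b, HasDerivWithinAt f (g t) (Ioi t) t) {t : ℝ} (ht : t ∈ Ioo a b) :
    HasDerivAt f (g t) t := by
  obtain ⟨c, hac, hct⟩ := exists_between ht.1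
  have key : ∀ s ∈ Ioo c b, f s = f c + ∫ y in c..s, g y := by
    intro s hs
    have hsub : Icc c s ⊆ Ioo a b := fun y hy => ⟨hac.trans_le hy.1, hy.2.trans_lt hs.2⟩
    rw [intervalIntegral.integral_eq_sub_of_hasDeriv_right_of_le hs.1.le (hf.mono hsub)
      (fun y hy => h y (hsub (Ioo_subset_Icc_self hy)))
      ((hg.mono hsub).intervalIntegrable_of_Icc hs.1.le)]
    abel
  have hsub : Icc c t ⊆ Ioo a b := fun y hy => ⟨hac.trans_le hy.1, hy.2.trans_lt ht.2⟩
  have hd : HasDerivAt (fun s => f c + ∫ y in c..s, g y) (g t) t := by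
    refine (intervalIntegral.integral_hasDerivAt_right
      ((hg.mono hsub).intervalIntegrable_of_Icc hct.le) ?_
      (hg.continuousAt (Ioo_mem_nhds ht.1 ht.2))).const_add _
    exact hg.stronglyMeasurableAtFilter isOpen_Ioo t ht
  refine hd.congr_of_eventuallyEq ?_
  filter_upwards [Ioo_mem_nhds hct ht.2] with s hs using key s hs

/-- The average of a continuous function over a shrinking interval converges. -/
theorem tendsto_inv_smul_integral_zero [CompleteSpace E] {F : ℝ → ℝ → E}
    (hF : Continuous (Function.uncurry F)) :
    Tendsto (fun η : ℝ => η⁻¹ • ∫ σ in (0 : ℝ)..η, F η σ) (𝓝[>] 0) (𝓝 (F 0 0)) := by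
  rw [Metric.tendsto_nhds]
  intro ε hε
  have hc := Metric.continuousAt_iff.1 (hF.continuousAt (x := ((0 : ℝ), (0 : ℝ)))) (ε / 2)
    (half_pos hε)
  obtain ⟨ρ, hρ, hc⟩ := hc
  filter_upwards [Ioo_mem_nhdsGT hρ] with η hη
  have hcont : Continuous (F η) := hF.comp (Continuous.prodMk_right η)
  have h1 : η⁻¹ • (∫ σ in (0 : ℝ)..η, F η σ) - F 0 0
      = η⁻¹ • ∫ σ in (0 : ℝ)..η, (F η σ - F 0 0) := by
    rw [intervalIntegral.integral_sub (hcont.intervalIntegrable _ _) (by simp),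
      intervalIntegral.integral_const, smul_sub, sub_zero, smul_smul, inv_mul_cancel₀ hη.1.ne',
      one_smul]
  rw [dist_eq_norm, h1, norm_smul, Real.norm_eq_abs, abs_of_pos (inv_pos.2 hη.1)]
  have h2 : ‖∫ σ in (0 : ℝ)..η, (F η σ - F 0 0)‖ ≤ ε / 2 * |η - 0| := by
    refine intervalIntegral.norm_integral_le_of_norm_le_const fun σ hσ => ?_
    rw [uIoc_of_le hη.1.le] at hσ
    have := hc (x := (η, σ)) (by
      rw [Prod.dist_eq, max_lt_iff]
      simp only [Real.dist_eq, sub_zero, abs_of_pos hη.1, abs_of_pos hσ.1]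
      exact ⟨hη.2, hσ.2.trans_lt hη.2⟩)
    rw [dist_eq_norm] at this
    exact this.le
  rw [sub_zero, abs_of_pos hη.1] at h2
  calc η⁻¹ * ‖∫ σ in (0 : ℝ)..η, (F η σ - F 0 0)‖ ≤ η⁻¹ * (ε / 2 * η) := by
        gcongr; exact inv_nonneg.2 hη.1.le
    _ = ε / 2 := by field_simp [hη.1.ne']
    _ < ε := half_lt_self hε

namespace LocalAnalyticSemigroup

variable {R : ℝ → E →L[ℝ] E} {δ M C : ℝ} (hR : LocalAnalyticSemigroup R δ M C)
include hR

theorem bound_nonneg : 0 ≤ M := (norm_nonneg _).trans (hR.norm_le 0)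

theorem norm_apply_le (t : ℝ) (x : E) : ‖R t x‖ ≤ M * ‖x‖ :=
  (R t).le_of_opNorm_le (hR.norm_le t) x

theorem tendsto_apply {X : Type*} {l : Filter X} {a : X → ℝ} {g : X → E} {s : ℝ} {x : E}
    (ha : Tendsto a l (𝓝 s)) (hg : Tendsto g l (𝓝 x)) :
    Tendsto (fun p => R (a p) (g p)) l (𝓝 (R s x)) := by
  have h1 : Tendsto (fun p => R (a p) (g p - x)) l (𝓝 0) := by
    refine squeeze_zero_norm (a := fun p => M * ‖g p - x‖)
      (fun p => hR.norm_apply_le _ _) ?_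
    simpa using (tendsto_iff_norm_sub_tendsto_zero.1 hg).const_mul M
  have h2 : Tendsto (fun p => R (a p) x) l (𝓝 (R s x)) := ((hR.continuous x).tendsto s).comp ha
  simpa using h1.add h2

theorem continuous_apply {X : Type*} [TopologicalSpace X] {a : X → ℝ} {g : X → E}
    (ha : Continuous a) (hg : Continuous g) : Continuous fun p => R (a p) (g p) :=
  continuous_iff_continuousAt.2 fun p => hR.tendsto_apply (ha.tendsto p) (hg.tendsto p)

theorem tendsto_deriv {σ : ℝ} (h0 : 0 < σ) (h1 : σ < δ) (x : E) :
    Tendsto (fun η : ℝ => η⁻¹ • (R (σ + η) x - R σ x)) (𝓝[>] 0)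
      (𝓝 (deriv (fun t => R t x) σ)) :=
  (hR.differentiableAt σ h0 h1 x).hasDerivAt.tendsto_slope_zero_right

theorem norm_slope_le {σ η : ℝ} (hσ : 0 < σ) (hη : 0 < η) (h : σ + η ≤ δ) (x : E) :
    ‖η⁻¹ • (R (σ + η) x - R σ x)‖ ≤ C / σ * ‖x‖ := by
  rw [norm_smul, Real.norm_eq_abs, abs_of_pos (inv_pos.2 hη)]
  calc η⁻¹ * ‖R (σ + η) x - R σ x‖ ≤ η⁻¹ * (C * η / σ * ‖x‖) := by
        gcongr; exact hR.norm_sub_le σ η hσ hη.le h x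
    _ = C / σ * ‖x‖ := by field_simp

theorem norm_deriv_le {σ : ℝ} (h0 : 0 < σ) (h1 : σ < δ) (x : E) :
    ‖deriv (fun t => R t x) σ‖ ≤ C / σ * ‖x‖ := by
  refine le_of_tendsto (hR.tendsto_deriv h0 h1 x).norm ?_
  filter_upwards [Ioo_mem_nhdsGT (sub_pos.2 h1)] with η hη
  exact hR.norm_slope_le h0 hη.1 (by linarith [hη.2]) x

theorem deriv_eq_zero {σ : ℝ} (h0 : σ < 0) (x : E) : deriv (fun t => R t x) σ = 0 := by
  have : (fun t => R t x) =ᶠ[𝓝 σ] fun _ => x := by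
    filter_upwards [Iio_mem_nhds h0] with t ht using hR.eq_of_nonpos t (le_of_lt ht) x
  rw [this.deriv_eq, deriv_const]

theorem deriv_sub_apply {σ : ℝ} (h0 : 0 < σ) (h1 : σ < δ) (x y : E) :
    deriv (fun t => R t (x - y)) σ = deriv (fun t => R t x) σ - deriv (fun t => R t y) σ := by
  simp only [map_sub]
  exact deriv_fun_sub (hR.differentiableAt σ h0 h1 x) (hR.differentiableAt σ h0 h1 y)

theorem continuous_deriv_apply {σ : ℝ} (h0 : 0 < σ) (h1 : σ < δ) :
    Continuous fun x => deriv (fun t => R t x) σ := by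
  refine continuous_iff_continuousAt.2 fun x => ?_
  rw [ContinuousAt, tendsto_iff_norm_sub_tendsto_zero]
  refine squeeze_zero (fun _ => norm_nonneg _) (g := fun y => C / σ * ‖y - x‖) (fun y => ?_) ?_
  · rw [← hR.deriv_sub_apply h0 h1]
    exact hR.norm_deriv_le h0 h1 _
  · simpa using ((tendsto_iff_norm_sub_tendsto_zero.1 tendsto_id).const_mul (C / σ) :
      Tendsto (fun y : E => C / σ * ‖y - x‖) (𝓝 x) _)

/-- The orbit of a point of the domain of the generator `G`: `(d/dt) R t x = R t (G x)` from the
right. -/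
theorem hasDerivWithinAt_orbit {x y : E} (hxy : HasGeneratorValue R x y) {t : ℝ} (h0 : 0 ≤ t)
    (h1 : t < δ) : HasDerivWithinAt (fun s => R s x) (R t y) (Ioi t) t := by
  rw [hasDerivWithinAt_Ioi_iff_tendsto]
  refine (((R t).continuous.tendsto y).comp hxy).congr' ?_
  filter_upwards [Ioo_mem_nhdsGT (sub_pos.2 h1)] with η hη
  simp [hR.map_add t η h0 hη.1.le (by linarith [hη.2])]

theorem hasGeneratorValue_orbit {x y : E} (hxy : HasGeneratorValue R x y) {t : ℝ} (h0 : 0 ≤ t)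
    (h1 : t < δ) : HasGeneratorValue R (R t x) (R t y) := by
  refine (((R t).continuous.tendsto y).comp hxy).congr' ?_
  filter_upwards [Ioo_mem_nhdsGT (sub_pos.2 h1)] with η hη
  simp [← hR.map_add t η h0 hη.1.le (by linarith [hη.2]),
    ← hR.map_add η t hη.1.le h0 (by linarith [hη.2]), add_comm]

/-- Orbits of points of the domain of the generator are Lipschitz. -/
theorem norm_orbit_sub_le {x y : E} (hxy : HasGeneratorValue R x y) {s t : ℝ} (h0 : 0 ≤ s)
    (hst : s ≤ t) (h1 : t ≤ δ) : ‖R t x - R s x‖ ≤ M * ‖y‖ * (t - s) := by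
  refine norm_image_sub_le_of_norm_deriv_right_le_segment (f := fun s => R s x)
    (f' := fun s => R s y) (hR.continuous x).continuousOn (fun u hu => ?_)
    (fun u _ => hR.norm_apply_le u y) t ⟨hst, le_rfl⟩
  exact hasDerivWithinAt_Ioi_iff_Ici.1
    (hR.hasDerivWithinAt_orbit hxy (h0.trans hu.1) (hu.2.trans_le h1))

end LocalAnalyticSemigroup

end LocalSemigroup

/-! ### The variation of constants formula -/

section Convolution

variable {E : Type*} [NormedAddCommGroup E] [NormedSpace ℝ E]

/-- The convolution `(R * f)(t) = ∫₀ᵗ R(σ) f(t - σ) dσ`, the mild solution of `u' = G u + f`,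
`u(0) = 0`, where `G` is the generator of `R`. -/
def semigroupConv (R : ℝ → E →L[ℝ] E) (f : ℝ → E) (t : ℝ) : E :=
  ∫ σ in (0 : ℝ)..t, R σ (f (t - σ))

/-- The derivative of `semigroupConv R f` for Lipschitz `f`. Subtracting `f t` inside the integral
compensates the singularity of `(d/dσ) R σ` at `σ = 0`, so that the integral converges. -/
def semigroupConvDeriv (R : ℝ → E →L[ℝ] E) (f : ℝ → E) (t : ℝ) : E :=
  (∫ σ in (0 : ℝ)..t, deriv (fun s => R s (f (t - σ) - f t)) σ) + R t (f t)

namespace LocalAnalyticSemigroup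

variable {R : ℝ → E →L[ℝ] E} {δ M C : ℝ}

theorem continuous_conv_integrand (hR : LocalAnalyticSemigroup R δ M C) {f : ℝ → E}
    (hf : Continuous f) (t : ℝ) : Continuous fun σ => R σ (f (t - σ)) :=
  hR.continuous_apply continuous_id (by fun_prop)

theorem continuous_semigroupConv [CompleteSpace E] (hR : LocalAnalyticSemigroup R δ M C)
    {f : ℝ → E} (hf : Continuous f) : Continuous (semigroupConv R f) := by
  refine intervalIntegral.continuous_parametric_intervalIntegral_of_continuous
    (f := fun t σ => R σ (f (t - σ))) ?_ continuous_id
  exact hR.continuous_apply continuous_snd (by fun_prop)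

theorem apply_semigroupConv [CompleteSpace E] (hR : LocalAnalyticSemigroup R δ M C)
    {f : ℝ → E} (hf : Continuous f) {t η : ℝ} (ht : 0 ≤ t) (hη : 0 ≤ η) (h : t + η ≤ δ) :
    R η (semigroupConv R f t) = ∫ σ in (0 : ℝ)..t, R (σ + η) (f (t - σ)) := by
  rw [semigroupConv, ← ContinuousLinearMap.intervalIntegral_comp_comm _
    ((hR.continuous_conv_integrand hf t).intervalIntegrable _ _)]
  refine intervalIntegral.integral_congr fun σ hσ => ?_
  rw [uIcc_of_le ht] at hσ
  rw [add_comm σ, hR.map_add η σ hη hσ.1 (by linarith [hσ.2])]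

theorem semigroupConv_add [CompleteSpace E] (hR : LocalAnalyticSemigroup R δ M C)
    {f : ℝ → E} (hf : Continuous f) {t η : ℝ} (ht : 0 ≤ t) (hη : 0 ≤ η) (h : t + η ≤ δ) :
    semigroupConv R f (t + η) =
      R η (semigroupConv R f t) + ∫ σ in (0 : ℝ)..η, R σ (f (t + η - σ)) := by
  have hc := hR.continuous_conv_integrand hf (t + η)
  rw [hR.apply_semigroupConv hf ht hη h, semigroupConv,
    ← intervalIntegral.integral_add_adjacent_intervals (hc.intervalIntegrable 0 η)
      (hc.intervalIntegrable η (t + η)), add_comm]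
  congr 1
  have := intervalIntegral.integral_comp_add_right (a := 0) (b := t)
    (fun σ => R σ (f (t + η - σ))) η
  rw [zero_add] at this
  rw [← this]
  simp

/-- `∫₀ᵗ R(σ) x dσ` lies in the domain of the generator, which maps it to `R(t) x - x`. -/
theorem hasGeneratorValue_integral [CompleteSpace E] (hR : LocalAnalyticSemigroup R δ M C)
    (x : E) {t : ℝ} (ht : 0 ≤ t) (h : t < δ) :
    HasGeneratorValue R (∫ σ in (0 : ℝ)..t, R σ x) (R t x - x) := by
  have hi : ∀ a b, IntervalIntegrable (fun σ => R σ x) volume a b :=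
    fun a b => (hR.continuous x).intervalIntegrable a b
  have h1 := tendsto_inv_smul_integral_zero (F := fun _ σ => R (t + σ) x)
    (hR.continuous_apply (a := fun p : ℝ × ℝ => t + p.2) (by fun_prop) continuous_const)
  have h2 := tendsto_inv_smul_integral_zero (F := fun _ σ => R σ x)
    (hR.continuous_apply (a := fun p : ℝ × ℝ => p.2) (by fun_prop) continuous_const)
  have h3 := h1.sub h2
  rw [add_zero, hR.eq_of_nonpos 0 le_rfl] at h3
  refine h3.congr' ?_
  filter_upwards [Ioo_mem_nhdsGT (sub_pos.2 h)] with η hη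
  have h4 := hR.apply_semigroupConv (f := fun _ => x) continuous_const ht hη.1.le
    (by linarith [hη.2])
  simp only [semigroupConv] at h4
  rw [h4, ← smul_sub]
  congr 1
  have e1 : ∫ σ in (0 : ℝ)..η, R (t + σ) x = ∫ σ in t..(t + η), R σ x := by
    simpa using intervalIntegral.integral_comp_add_left (a := 0) (b := η) (fun σ => R σ x) t
  have e2 : ∫ σ in (0 : ℝ)..t, R (σ + η) x = ∫ σ in η..(t + η), R σ x := by
    simpa using intervalIntegral.integral_comp_add_right (a := 0) (b := t) (fun σ => R σ x) η
  rw [e1, e2, ← intervalIntegral.integral_add_adjacent_intervals (hi 0 η) (hi η t),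
    ← intervalIntegral.integral_add_adjacent_intervals (hi η t) (hi t (t + η))]
  abel

/-- For Lipschitz `f`, the values of the convolution lie in the domain of the generator. The
difference quotients of the part with `f(t - σ) - f(t)` are dominated by a constant: the factor
`C / σ` from the semigroup is compensated by `‖f(t - σ) - f(t)‖ ≤ L σ`. -/
theorem hasGeneratorValue_semigroupConv [CompleteSpace E] (hR : LocalAnalyticSemigroup R δ M C)
    {f : ℝ → E} {L : ℝ} (hf : ∀ s t, ‖f s - f t‖ ≤ L * |s - t|) (hfc : Continuous f) {t : ℝ}
    (ht : 0 ≤ t) (h : t < δ) :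
    HasGeneratorValue R (semigroupConv R f t) (semigroupConvDeriv R f t - f t) := by
  have hdom : Tendsto (fun η : ℝ => ∫ σ in (0 : ℝ)..t,
      η⁻¹ • (R (σ + η) (f (t - σ) - f t) - R σ (f (t - σ) - f t))) (𝓝[>] 0)
      (𝓝 (∫ σ in (0 : ℝ)..t, deriv (fun s => R s (f (t - σ) - f t)) σ)) := by
    refine intervalIntegral.tendsto_integral_filter_of_dominated_convergence
      (fun _ => |C| * L) ?_ ?_ (by simp) ?_
    · refine Eventually.of_forall fun η => Continuous.aestronglyMeasurable ?_
      refine continuous_const.smul ?_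
      exact (hR.continuous_apply (by fun_prop) (by fun_prop)).sub
        (hR.continuous_apply (by fun_prop) (by fun_prop))
    · filter_upwards [Ioo_mem_nhdsGT (sub_pos.2 h)] with η hη
      refine Eventually.of_forall fun σ hσ => ?_
      rw [uIoc_of_le ht] at hσ
      refine (hR.norm_slope_le hσ.1 hη.1 (by linarith [hη.2, hσ.2]) _).trans ?_
      have h1 := hf (t - σ) t
      rw [show t - σ - t = -σ by ring, abs_neg, abs_of_pos hσ.1] at h1
      calc C / σ * ‖f (t - σ) - f t‖ ≤ |C| / σ * (L * σ) := by
            gcongr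
            · exact div_nonneg (abs_nonneg _) hσ.1.le
            · exact hσ.1.le
            · exact le_abs_self C
        _ = |C| * L := by have := hσ.1.ne'; field_simp
    · refine Eventually.of_forall fun σ hσ => ?_
      rw [uIoc_of_le ht] at hσ
      exact hR.tendsto_deriv hσ.1 (hσ.2.trans_lt h) _
  have h2 := hdom.add (hR.hasGeneratorValue_integral (f t) ht h)
  rw [semigroupConvDeriv, add_sub_assoc]
  refine h2.congr' ?_
  filter_upwards [Ioo_mem_nhdsGT (sub_pos.2 h)] with η hη
  have hle : t + η ≤ δ := by linarith [hη.2]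
  have h4 := hR.apply_semigroupConv (f := fun _ => f t) continuous_const ht hη.1.le hle
  simp only [semigroupConv] at h4
  rw [intervalIntegral.integral_smul, ← smul_add, hR.apply_semigroupConv hfc ht hη.1.le hle, h4,
    semigroupConv]
  congr 1
  have c1 : Continuous fun σ => R (σ + η) (f (t - σ)) :=
    hR.continuous_apply (by fun_prop) (by fun_prop)
  have c2 : Continuous fun σ => R (σ + η) (f t) :=
    hR.continuous_apply (by fun_prop) (by fun_prop)
  have c3 := hR.continuous_conv_integrand hfc t
  have c4 := hR.continuous (f t)
  have c5 : Continuous fun σ => R (σ + η) (f (t - σ)) - R (σ + η) (f t) := c1.sub c2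
  have c6 : Continuous fun σ => R σ (f (t - σ)) - R σ (f t) := c3.sub c4
  simp only [_root_.map_sub]
  rw [intervalIntegral.integral_sub (c5.intervalIntegrable _ _)
      (c6.intervalIntegrable _ _),
    intervalIntegral.integral_sub (c1.intervalIntegrable _ _) (c2.intervalIntegrable _ _),
    intervalIntegral.integral_sub (c3.intervalIntegrable _ _) (c4.intervalIntegrable _ _)]
  abel

theorem hasDerivWithinAt_semigroupConv [CompleteSpace E] (hR : LocalAnalyticSemigroup R δ M C)
    {f : ℝ → E} {L : ℝ} (hf : ∀ s t, ‖f s - f t‖ ≤ L * |s - t|) (hfc : Continuous f) {t : ℝ}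
    (ht : 0 ≤ t) (h : t < δ) :
    HasDerivWithinAt (semigroupConv R f) (semigroupConvDeriv R f t) (Ioi t) t := by
  rw [hasDerivWithinAt_Ioi_iff_tendsto]
  have h1 := tendsto_inv_smul_integral_zero (F := fun η σ => R σ (f (t + η - σ)))
    (hR.continuous_apply (a := fun p : ℝ × ℝ => p.2) (by fun_prop) (by fun_prop))
  simp only [hR.eq_of_nonpos 0 le_rfl, add_zero, sub_zero] at h1
  have h2 := (hR.hasGeneratorValue_semigroupConv hf hfc ht h).add h1
  rw [sub_add_cancel] at h2
  refine h2.congr' ?_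
  filter_upwards [Ioo_mem_nhdsGT (sub_pos.2 h)] with η hη
  rw [hR.semigroupConv_add hfc ht hη.1.le (by linarith [hη.2]), ← smul_add]
  congr 1
  abel

theorem continuousAt_semigroupConvDeriv [CompleteSpace E] (hR : LocalAnalyticSemigroup R δ M C)
    {f : ℝ → E} {L : ℝ} (hf : ∀ s t, ‖f s - f t‖ ≤ L * |s - t|) (hfc : Continuous f) {t : ℝ}
    (ht : 0 < t) (h : t < δ) : ContinuousAt (semigroupConvDeriv R f) t := by
  have hL : 0 ≤ L := by simpa using (norm_nonneg _).trans (hf 1 0)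
  obtain ⟨b, htb, hb⟩ := exists_between h
  -- All integrands are defined by `deriv`, which vanishes for `σ < 0`; at the singular point
  -- `σ = 0`, a null set, nothing is known.
  have hae : ∀ᵐ σ : ℝ ∂volume.restrict (uIoc (-1) b), σ ∈ Ioc (-1) b ∧ σ ≠ 0 := by
    rw [uIoc_of_le (by linarith)]
    filter_upwards [ae_restrict_mem measurableSet_Ioc,
      ae_restrict_of_ae (compl_mem_ae_iff.2 (measure_singleton (0 : ℝ)))] with σ h1 h2
    exact ⟨h1, h2⟩
  refine ContinuousAt.add ?_ (hR.continuous_apply continuous_id hfc).continuousAt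
  have key := intervalIntegral.continuousAt_parametric_primitive_of_dominated (μ := volume)
    (F := fun t σ => deriv (fun s => R s (f (t - σ) - f t)) σ) (fun _ => |C| * L) (-1) b
    (a₀ := 0) (b₀ := t) (x₀ := t) ?_ ?_ (by simp) ?_ ⟨by norm_num, ht.trans htb⟩
    ⟨by linarith, htb⟩ (measure_singleton t)
  · exact ContinuousAt.comp (f := fun t : ℝ => (t, t)) key (by fun_prop)
  · intro s
    refine aestronglyMeasurable_of_tendsto_ae (u := 𝓝[>] (0 : ℝ))
      (f := fun η σ => η⁻¹ • (R (σ + η) (f (s - σ) - f s) - R σ (f (s - σ) - f s)))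
      (fun η => Continuous.aestronglyMeasurable ?_) ?_
    · refine continuous_const.smul ?_
      exact (hR.continuous_apply (by fun_prop) (by fun_prop)).sub
        (hR.continuous_apply (by fun_prop) (by fun_prop))
    · filter_upwards [hae] with σ hσ
      rcases lt_or_gt_of_ne hσ.2 with h0 | h0
      · rw [hR.deriv_eq_zero h0]
        refine tendsto_const_nhds.congr' ?_
        filter_upwards [Ioo_mem_nhdsGT (neg_pos.2 h0)] with η hη
        rw [hR.eq_of_nonpos (σ + η) (by linarith [hη.2]), hR.eq_of_nonpos σ h0.le, sub_self,
          smul_zero]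
      · exact hR.tendsto_deriv h0 (hσ.1.2.trans_lt hb) _
  · refine Eventually.of_forall fun s => ?_
    filter_upwards [hae] with σ hσ
    rcases lt_or_gt_of_ne hσ.2 with h0 | h0
    · rw [hR.deriv_eq_zero h0, norm_zero]
      positivity
    · refine (hR.norm_deriv_le h0 (hσ.1.2.trans_lt hb) _).trans ?_
      have h1 := hf (s - σ) s
      rw [show s - σ - s = -σ by ring, abs_neg, abs_of_pos h0] at h1
      calc C / σ * ‖f (s - σ) - f s‖ ≤ |C| / σ * (L * σ) := by
            gcongr
            exact le_abs_self C
        _ = |C| * L := by field_simp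
  · filter_upwards [hae] with σ hσ
    rcases lt_or_gt_of_ne hσ.2 with h0 | h0
    · simp only [hR.deriv_eq_zero h0]
      exact continuousAt_const
    · exact ((hR.continuous_deriv_apply h0 (hσ.1.2.trans_lt hb)).comp
        (g := fun x => deriv (fun s => R s x) σ) (f := fun s => f (s - σ) - f s)
        (by fun_prop)).continuousAt

/-- For Lipschitz `f` and `x` in the domain of the generator, the mild solution of `u' = G u + f`,
`u(0) = x`, is continuously differentiable and solves the equation. -/
theorem hasDerivAt_mild [CompleteSpace E] (hR : LocalAnalyticSemigroup R δ M C)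
    {f : ℝ → E} {L : ℝ} (hf : ∀ s t, ‖f s - f t‖ ≤ L * |s - t|) (hfc : Continuous f) {x y : E}
    (hxy : HasGeneratorValue R x y) {t : ℝ} (ht : t ∈ Ioo 0 δ) :
    HasDerivAt (fun s => R s x + semigroupConv R f s) (R t y + semigroupConvDeriv R f t) t := by
  refine hasDerivAt_of_continuousOn_right_deriv (a := 0) (b := δ)
    (g := fun t => R t y + semigroupConvDeriv R f t) ?_ ?_ (fun s hs => ?_) ht
  · exact ((hR.continuous x).add (hR.continuous_semigroupConv hfc)).continuousOn
  · exact (hR.continuous y).continuousOn.add fun s hs =>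
      (hR.continuousAt_semigroupConvDeriv hf hfc hs.1 hs.2).continuousWithinAt
  · exact (hR.hasDerivWithinAt_orbit hxy hs.1.le hs.2).add
      (hR.hasDerivWithinAt_semigroupConv hf hfc hs.1.le hs.2)

theorem hasGeneratorValue_mild [CompleteSpace E] (hR : LocalAnalyticSemigroup R δ M C)
    {f : ℝ → E} {L : ℝ} (hf : ∀ s t, ‖f s - f t‖ ≤ L * |s - t|) (hfc : Continuous f) {x y : E}
    (hxy : HasGeneratorValue R x y) {t : ℝ} (ht : t ∈ Ioo 0 δ) :
    HasGeneratorValue R (R t x + semigroupConv R f t)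
      (R t y + semigroupConvDeriv R f t - f t) := by
  have h := (hR.hasGeneratorValue_orbit hxy ht.1.le ht.2).add
    (hR.hasGeneratorValue_semigroupConv hf hfc ht.1.le ht.2)
  rw [← add_sub_assoc] at h
  refine h.congr fun η => ?_
  rw [← smul_add, _root_.map_add]
  congr 1
  abel

/-- A classical solution of `v' = G v + g` is a mild solution: on `(0, t)` the right derivative of
`s ↦ R(t - s) v(s)` is `R(t - s) g(s)`. -/
theorem eq_mild_of_hasDerivAt [CompleteSpace E] (hR : LocalAnalyticSemigroup R δ M C)
    {v v' g : ℝ → E} {t : ℝ} (ht : 0 ≤ t) (htδ : t ≤ δ) (hv : ContinuousOn v (Icc 0 t))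
    (hg : Continuous g) (hd : ∀ s ∈ Ioo 0 t, HasDerivAt v (v' s) s)
    (hG : ∀ s ∈ Ioo 0 t, HasGeneratorValue R (v s) (v' s - g s)) :
    v t = R t (v 0) + semigroupConv R g t := by
  have hk : ContinuousOn (fun s => R (t - s) (v s)) (Icc 0 t) := fun s hs =>
    hR.tendsto_apply (Continuous.continuousWithinAt (f := fun s => t - s) (by fun_prop)) (hv s hs)
  have hint : Continuous fun s => R (t - s) (g s) := hR.continuous_apply (by fun_prop) hg
  have h1 := intervalIntegral.integral_eq_sub_of_hasDeriv_right_of_le ht hk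
    (f' := fun s => R (t - s) (g s)) ?_ (hint.intervalIntegrable _ _)
  · have h2 := intervalIntegral.integral_comp_sub_left (a := 0) (b := t)
      (fun σ => R σ (g (t - σ))) t
    simp only [sub_sub_cancel, sub_self, sub_zero] at h2
    rw [h2] at h1
    simp only [sub_self, sub_zero, hR.eq_of_nonpos 0 le_rfl] at h1
    rw [semigroupConv, h1]
    abel
  · intro s hs
    rw [hasDerivWithinAt_Ioi_iff_tendsto]
    have h3 := ((hd s hs).tendsto_slope_zero_right).sub (hG s hs)
    rw [sub_sub_cancel] at h3
    have h4 : Tendsto (fun η : ℝ => t - (s + η)) (𝓝[>] 0) (𝓝 (t - s)) := by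
      refine tendsto_nhdsWithin_of_tendsto_nhds ?_
      exact Continuous.tendsto' (by fun_prop) _ _ (by simp)
    refine (hR.tendsto_apply h4 h3).congr' ?_
    filter_upwards [Ioo_mem_nhdsGT (sub_pos.2 hs.2)] with η hη
    have h5 := hR.map_add (t - (s + η)) η (by linarith [hη.2]) hη.1.le (by linarith [hs.1]) (v s)
    rw [show t - (s + η) + η = t - s by ring] at h5
    rw [h5]
    simp only [_root_.map_sub, map_smul, ← smul_sub]
    congr 1
    abel

end LocalAnalyticSemigroup

end Convolution

/-! ### Estimates for the delay term -/

section DelayEstimates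

variable {E : Type*} [NormedAddCommGroup E] {h : ℝ}

/-- The history `θ ↦ u(t + θ)` of a function that is continuous on the whole real line. -/
def historyOf (u : ℝ → E) (hu : Continuous u) (t : ℝ) : HistorySpace h E where
  toFun θ := u (t + (θ : ℝ))
  continuous_toFun := by fun_prop

theorem continuous_historyOf (u : ℝ → E) (hu : Continuous u) :
    Continuous (historyOf (h := h) u hu) :=
  (ContinuousMap.curry (⟨fun p : ℝ × Icc (-h) (0 : ℝ) => u (p.1 + (p.2 : ℝ)), by fun_prop⟩ :
    C(ℝ × Icc (-h) (0 : ℝ), E))).continuous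

theorem norm_historyOf_sub_le {u v : ℝ → E} (hu : Continuous u) (hv : Continuous v) {s t D : ℝ}
    (hD : 0 ≤ D) (huv : ∀ θ ∈ Icc (-h) 0, ‖u (s + θ) - v (t + θ)‖ ≤ D) :
    ‖historyOf (h := h) u hu s - historyOf v hv t‖ ≤ D :=
  (ContinuousMap.norm_le _ hD).2 fun θ => huv θ θ.2

theorem continuous_delayTerm {B : E → E} {r : HistorySpace h E → Icc (0 : ℝ) h}
    (hB : Continuous B) (hr : Continuous r) : Continuous (delayTerm B r) := by
  have hn : Continuous (negDelay (h := h)) :=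
    Continuous.subtype_mk (continuous_subtype_val.neg) _
  exact hB.comp (continuous_eval.comp (continuous_id.prodMk (hn.comp hr)))

/-- The delay term is not Lipschitz on the phase space, but it is Lipschitz at every Lipschitz
history: evaluating a `K`-Lipschitz `ψ₁` at the two delays costs `K |r(ψ₁) - r(ψ₂)|`. Only one of
the two histories has to be Lipschitz. -/
theorem norm_delayTerm_sub_le {B : E → E} {r : HistorySpace h E → Icc (0 : ℝ) h} {LB Lr : NNReal}
    (hB : LipschitzWith LB B) (hr : LipschitzWith Lr r) {K : ℝ} (hK : 0 ≤ K)
    {ψ₁ ψ₂ : HistorySpace h E} (hψ : ∀ a b, ‖ψ₁ a - ψ₁ b‖ ≤ K * |(a : ℝ) - b|) :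
    ‖delayTerm B r ψ₁ - delayTerm B r ψ₂‖ ≤ LB * (K * Lr + 1) * ‖ψ₁ - ψ₂‖ := by
  have h1 := hB.dist_le_mul (ψ₁ (negDelay (r ψ₁))) (ψ₂ (negDelay (r ψ₂)))
  rw [dist_eq_norm, dist_eq_norm] at h1
  refine h1.trans ?_
  rw [mul_assoc]
  gcongr
  have h2 := hψ (negDelay (r ψ₁)) (negDelay (r ψ₂))
  have h3 : |((negDelay (r ψ₁) : Icc (-h) (0 : ℝ)) : ℝ) - (negDelay (r ψ₂) : Icc (-h) (0 : ℝ))|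
      ≤ Lr * ‖ψ₁ - ψ₂‖ := by
    have h4 := hr.dist_le_mul ψ₁ ψ₂
    rw [Subtype.dist_eq, Real.dist_eq, dist_eq_norm] at h4
    simp only [negDelay]
    rwa [neg_sub_neg, abs_sub_comm]
  have h5 : ‖ψ₁ (negDelay (r ψ₂)) - ψ₂ (negDelay (r ψ₂))‖ ≤ ‖ψ₁ - ψ₂‖ :=
    ContinuousMap.norm_coe_le_norm (ψ₁ - ψ₂) (negDelay (r ψ₂))
  calc ‖ψ₁ (negDelay (r ψ₁)) - ψ₂ (negDelay (r ψ₂))‖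
      ≤ ‖ψ₁ (negDelay (r ψ₁)) - ψ₁ (negDelay (r ψ₂))‖
        + ‖ψ₁ (negDelay (r ψ₂)) - ψ₂ (negDelay (r ψ₂))‖ := norm_sub_le_norm_sub_add_norm_sub _ _ _
    _ ≤ K * (Lr * ‖ψ₁ - ψ₂‖) + ‖ψ₁ - ψ₂‖ := by
        gcongr
        exact h2.trans (by gcongr)
    _ = (K * Lr + 1) * ‖ψ₁ - ψ₂‖ := by ring

/-- Along a `K`-Lipschitz function `u` and a continuous function `v`, the delay terms differ by at
most a multiple of the sup distance of the histories. -/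
theorem norm_delayTerm_historyOf_sub_le {B : E → E} {r : HistorySpace h E → Icc (0 : ℝ) h}
    {LB Lr : NNReal} (hB : LipschitzWith LB B) (hr : LipschitzWith Lr r) {K : ℝ} (hK : 0 ≤ K)
    {u v : ℝ → E} (hu : Continuous u) (hv : Continuous v)
    (hul : ∀ a b, ‖u a - u b‖ ≤ K * |a - b|) {s t D : ℝ} (hD : 0 ≤ D)
    (huv : ∀ θ ∈ Icc (-h) 0, ‖u (s + θ) - v (t + θ)‖ ≤ D) :
    ‖delayTerm B r (historyOf u hu s) - delayTerm B r (historyOf v hv t)‖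
      ≤ LB * (K * Lr + 1) * D := by
  refine (norm_delayTerm_sub_le hB hr hK fun a b => ?_).trans ?_
  · have := hul (s + a) (s + b)
    rwa [add_sub_add_left_eq_sub] at this
  · gcongr
    exact norm_historyOf_sub_le hu hv hD huv

end DelayEstimates

/-! ### Mild solutions of the delay equation -/

section Mild

variable {E : Type*} [NormedAddCommGroup E] [NormedSpace ℝ E]
  {R : ℝ → E →L[ℝ] E} {δ M C : ℝ}

/-- The continuous function `u` solves the integral equation
`u(t) = R(t) u(0) + ∫₀ᵗ R(t - s) F(u_s) ds` on `[0, T]`. -/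
structure IsMildSolution {h : ℝ} (R : ℝ → E →L[ℝ] E) (F : HistorySpace h E → E) (T : ℝ)
    (u : ℝ → E) (hu : Continuous u) : Prop where
  eq_conv : ∀ t ∈ Icc 0 T, u t = R t (u 0) + semigroupConv R (fun s => F (historyOf u hu s)) t

namespace LocalAnalyticSemigroup

theorem norm_semigroupConv_sub_le (hR : LocalAnalyticSemigroup R δ M C) {f g : ℝ → E}
    (hf : Continuous f) (hg : Continuous g) {t D : ℝ} (ht : 0 ≤ t)
    (hfg : ∀ s ∈ Icc 0 t, ‖f s - g s‖ ≤ D) :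
    ‖semigroupConv R f t - semigroupConv R g t‖ ≤ M * D * t := by
  rw [semigroupConv, semigroupConv, ← intervalIntegral.integral_sub
    ((hR.continuous_conv_integrand hf t).intervalIntegrable _ _)
    ((hR.continuous_conv_integrand hg t).intervalIntegrable _ _)]
  refine (intervalIntegral.norm_integral_le_of_norm_le_const (C := M * D) fun σ hσ => ?_).trans ?_
  · rw [uIoc_of_le ht] at hσ
    rw [← map_sub]
    refine (hR.norm_apply_le _ _).trans ?_
    have := hR.bound_nonneg
    gcongr
    exact hfg _ ⟨by linarith [hσ.2], by linarith [hσ.1]⟩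
  · rw [sub_zero, abs_of_nonneg ht]

/-- The convolution with a bounded Lipschitz function is Lipschitz; the Lipschitz constant `L` of the
function enters only with the factor `T`. -/
theorem norm_semigroupConv_sub_le_of_lipschitz (hR : LocalAnalyticSemigroup R δ M C) {f : ℝ → E}
    (hfc : Continuous f) {L b T : ℝ} (hf : ∀ s t, ‖f s - f t‖ ≤ L * |s - t|)
    (hb : ∀ s ∈ Icc 0 T, ‖f s‖ ≤ b) {s t : ℝ} (hs : 0 ≤ s) (hst : s ≤ t) (htT : t ≤ T) :
    ‖semigroupConv R f t - semigroupConv R f s‖ ≤ M * (L * T + b) * (t - s) := by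
  have hM := hR.bound_nonneg
  have hL : 0 ≤ L := by simpa using (norm_nonneg _).trans (hf 1 0)
  have hc := hR.continuous_conv_integrand hfc
  have e : semigroupConv R f t - semigroupConv R f s =
      (∫ σ in (0 : ℝ)..s, R σ (f (t - σ) - f (s - σ))) + ∫ σ in s..t, R σ (f (t - σ)) := by
    simp only [map_sub]
    rw [intervalIntegral.integral_sub ((hc t).intervalIntegrable _ _)
      ((hc s).intervalIntegrable _ _), semigroupConv, semigroupConv,
      ← intervalIntegral.integral_add_adjacent_intervals ((hc t).intervalIntegrable 0 s)
        ((hc t).intervalIntegrable s t)]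
    abel
  have h1 : ‖∫ σ in (0 : ℝ)..s, R σ (f (t - σ) - f (s - σ))‖ ≤ M * (L * (t - s)) * |s - 0| := by
    refine intervalIntegral.norm_integral_le_of_norm_le_const fun σ _ => ?_
    refine (hR.norm_apply_le _ _).trans ?_
    gcongr
    have := hf (t - σ) (s - σ)
    rwa [show t - σ - (s - σ) = t - s by ring, abs_of_nonneg (sub_nonneg.2 hst)] at this
  have h2 : ‖∫ σ in s..t, R σ (f (t - σ))‖ ≤ M * b * |t - s| := by
    refine intervalIntegral.norm_integral_le_of_norm_le_const fun σ hσ => ?_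
    rw [uIoc_of_le hst] at hσ
    refine (hR.norm_apply_le _ _).trans ?_
    gcongr
    exact hb _ ⟨by linarith [hσ.2], by linarith [hσ.1]⟩
  rw [sub_zero, abs_of_nonneg hs] at h1
  rw [abs_of_nonneg (sub_nonneg.2 hst)] at h2
  have h3 : M * (L * (t - s)) * s ≤ M * (L * (t - s)) * T := by
    have := sub_nonneg.2 hst
    gcongr
    linarith
  calc _ ≤ _ := by rw [e]; exact norm_add_le _ _
    _ ≤ M * (L * (t - s)) * T + M * b * (t - s) := add_le_add (h1.trans h3) h2
    _ = _ := by ring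

/-- Existence of a Lipschitz mild solution. The fixed point is sought among the `K`-Lipschitz
functions with the given history; for small `T`, the integral operator maps this set to itself,
since the Lipschitz constant of `t ↦ F(u_t)` enters the one of the convolution only with the
factor `T`. -/
theorem exists_isMildSolution [CompleteSpace E] (hR : LocalAnalyticSemigroup R δ M C) {h : ℝ} {B : E → E}
    {r : HistorySpace h E → Icc (0 : ℝ) h} {LB Lr : NNReal} (hB : LipschitzWith LB B)
    (hr : LipschitzWith Lr r) {φ : ℝ → E} {Lφ bφ : ℝ} (hφ : ∀ s t, ‖φ s - φ t‖ ≤ Lφ * |s - t|)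
    (hφb : ∀ t, ‖φ t‖ ≤ bφ) (hφ0 : ∀ t, 0 ≤ t → φ t = φ 0) {y : E}
    (hy : HasGeneratorValue R (φ 0) y) :
    ∃ T K : ℝ, 0 < T ∧ T < δ ∧ 0 ≤ K ∧ M * (LB * (K * Lr + 1)) * T ≤ 1 / 2 ∧
      ∃ (u : ℝ → E) (hu : Continuous u), (∀ s t, ‖u s - u t‖ ≤ K * |s - t|) ∧
        (∀ t ≤ 0, u t = φ t) ∧ IsMildSolution R (delayTerm B r) T u hu := by
  have hM := hR.bound_nonneg
  have hδ := hR.delta_pos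
  have hLφ : 0 ≤ Lφ := by simpa using (norm_nonneg _).trans (hφ 1 0)
  have hφc : Continuous φ := by
    refine (LipschitzWith.of_dist_le_mul (K := Lφ.toNNReal) fun s t => ?_).continuous
    rw [dist_eq_norm, Real.dist_eq, Real.coe_toNNReal _ hLφ]
    exact hφ s t
  set b := ‖delayTerm B r (historyOf φ hφc 0)‖ with hb
  -- The three summands of `K` are Lipschitz constants of the history, of `t ↦ R(t) φ(0)`, and of the
  -- convolution, whose source term stays below `b + 1/2` in norm on the short interval `[0, T]`.
  set K := Lφ + M * ‖y‖ + M * (b + 1) with hKdef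
  have hb0 : 0 ≤ b := norm_nonneg _
  have hK : 0 ≤ K := by positivity
  set N : ℝ := LB * (K * Lr + 1) with hN
  have hN0 : 0 ≤ N := by positivity
  set T := min (δ / 2) (1 / (2 * (N * K + M * N + 1))) with hT
  have hT0 : 0 < T := lt_min (by linarith) (by positivity)
  have hTδ : T < δ := (min_le_left _ _).trans_lt (by linarith)
  have hTle : (N * K + M * N + 1) * T ≤ 1 / 2 := by
    calc (N * K + M * N + 1) * T ≤ (N * K + M * N + 1) * (1 / (2 * (N * K + M * N + 1))) := by
          gcongr; exact min_le_right _ _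
      _ = 1 / 2 := by field_simp
  have hT1 : N * K * T ≤ 1 / 2 := by
    have : 0 ≤ M * N * T := by positivity
    nlinarith
  have hT2 : M * N * T ≤ 1 / 2 := by
    have : 0 ≤ N * K * T := by positivity
    nlinarith
  refine ⟨T, K, hT0, hTδ, hK, hT2, ?_⟩
  let S : Set (BoundedContinuousFunction ℝ E) :=
    {u | (∀ s t, ‖u s - u t‖ ≤ K * |s - t|) ∧ ∀ t ≤ 0, u t = φ t}
  let f : BoundedContinuousFunction ℝ E → ℝ → E := fun u s =>
    delayTerm B r (historyOf u u.continuous s)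
  have hfc : ∀ u, Continuous (f u) := fun u =>
    (continuous_delayTerm hB.continuous hr.continuous).comp (continuous_historyOf _ _)
  let τ : ℝ → ℝ := fun t => (projIcc 0 T hT0.le t : ℝ)
  have hτ : ∀ t, τ t ∈ Icc 0 T := fun t => (projIcc 0 T hT0.le t).2
  have hτl : ∀ s t, |τ s - τ t| ≤ |s - t| := fun s t => by
    simpa [Subtype.dist_eq, Real.dist_eq] using
      (LipschitzWith.projIcc hT0.le).dist_le_mul s t
  -- The fixed point map. On `t ≤ 0` the last two summands vanish, on `t ≥ 0` the first one is
  -- constant, so that no case distinction is needed.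
  let Φ : BoundedContinuousFunction ℝ E → ℝ → E := fun u t =>
    φ t + (R (τ t) (φ 0) - φ 0) + semigroupConv R (f u) (τ t)
  have hfl : ∀ u ∈ S, ∀ s t, ‖f u s - f u t‖ ≤ N * K * |s - t| := by
    intro u hu s t
    have := norm_delayTerm_historyOf_sub_le hB hr hK u.continuous u.continuous hu.1
      (s := s) (t := t) (D := K * |s - t|) (by positivity)
      (fun θ _ => by simpa using hu.1 (s + θ) (t + θ))
    calc _ ≤ _ := this
      _ = _ := by rw [hN]; ring
  have hfb : ∀ u ∈ S, ∀ s ∈ Icc 0 T, ‖f u s‖ ≤ b + 1 / 2 := by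
    intro u hu s hs
    have h0 : f u 0 = delayTerm B r (historyOf φ hφc 0) := by
      simp only [f]
      congr 1
      ext θ
      exact hu.2 (0 + θ) (by linarith [θ.2.2])
    have h1 := hfl u hu s 0
    rw [sub_zero, abs_of_nonneg hs.1, h0] at h1
    have h2 : N * K * s ≤ N * K * T := by gcongr; exact hs.2
    calc ‖f u s‖ ≤ ‖f u s - delayTerm B r (historyOf φ hφc 0)‖ + b := by
          simpa using norm_add_le (f u s - delayTerm B r (historyOf φ hφc 0))
            (delayTerm B r (historyOf φ hφc 0))
      _ ≤ b + 1 / 2 := by linarith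
  have hmain : ∀ u ∈ S, ∀ s ∈ Icc 0 T, ∀ t ∈ Icc 0 T, s ≤ t →
      ‖(R t (φ 0) + semigroupConv R (f u) t) - (R s (φ 0) + semigroupConv R (f u) s)‖
        ≤ (M * ‖y‖ + M * (b + 1)) * (t - s) := by
    intro u hu s hs t ht hst
    have h1 := hR.norm_orbit_sub_le hy hs.1 hst (ht.2.trans hTδ.le)
    have h2 := hR.norm_semigroupConv_sub_le_of_lipschitz (hfc u) (hfl u hu) (hfb u hu)
      hs.1 hst ht.2
    have h3 : M * (N * K * T + (b + 1 / 2)) * (t - s) ≤ M * (b + 1) * (t - s) := by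
      have := sub_nonneg.2 hst
      have h4 : N * K * T + (b + 1 / 2) ≤ b + 1 := by linarith
      gcongr
    rw [add_sub_add_comm]
    refine (norm_add_le _ _).trans ?_
    linarith
  have hex : ∀ u : S, ∃ v : S, ∀ t, (v : BoundedContinuousFunction ℝ E) t = Φ u t := by
    rintro ⟨u, hu⟩
    have hl : ∀ s t, ‖Φ u s - Φ u t‖ ≤ K * |s - t| := by
      intro s t
      have h1 : ‖(R (τ s) (φ 0) + semigroupConv R (f u) (τ s))
          - (R (τ t) (φ 0) + semigroupConv R (f u) (τ t))‖
          ≤ (M * ‖y‖ + M * (b + 1)) * |τ s - τ t| := by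
        rcases le_total (τ s) (τ t) with hst | hst
        · rw [norm_sub_rev, abs_sub_comm, abs_of_nonneg (sub_nonneg.2 hst)]
          exact hmain u hu _ (hτ s) _ (hτ t) hst
        · rw [abs_of_nonneg (sub_nonneg.2 hst)]
          exact hmain u hu _ (hτ t) _ (hτ s) hst
      have h2 : (M * ‖y‖ + M * (b + 1)) * |τ s - τ t| ≤ (M * ‖y‖ + M * (b + 1)) * |s - t| := by
        exact mul_le_mul_of_nonneg_left (hτl s t) (by positivity)
      calc ‖Φ u s - Φ u t‖ = ‖(φ s - φ t) + ((R (τ s) (φ 0) + semigroupConv R (f u) (τ s))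
          - (R (τ t) (φ 0) + semigroupConv R (f u) (τ t)))‖ := by
            congr 1
            simp only [Φ]
            abel
        _ ≤ Lφ * |s - t| + (M * ‖y‖ + M * (b + 1)) * |s - t| :=
            (norm_add_le _ _).trans (add_le_add (hφ s t) (h1.trans h2))
        _ = K * |s - t| := by rw [hKdef]; ring
    have hc : Continuous (Φ u) := by
      refine (LipschitzWith.of_dist_le_mul (K := K.toNNReal) fun s t => ?_).continuous
      rw [dist_eq_norm, Real.dist_eq, Real.coe_toNNReal _ hK]
      exact hl s t
    have hbd : ∀ t, ‖Φ u t‖ ≤ bφ + (M * ‖φ 0‖ + ‖φ 0‖) + M * (b + 1 / 2) * T := by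
      intro t
      have h1 : ‖semigroupConv R (f u) (τ t)‖ ≤ M * (b + 1 / 2) * T := by
        have h2 := hR.norm_semigroupConv_sub_le (hfc u) (continuous_const (y := (0 : E))) (hτ t).1
          (D := b + 1 / 2) (fun s hs => by
            simpa using hfb u hu s ⟨hs.1, hs.2.trans (hτ t).2⟩)
        simp only [semigroupConv, map_zero, intervalIntegral.integral_zero, sub_zero] at h2
        refine h2.trans ?_
        gcongr
        exact (hτ t).2
      refine (norm_add_le _ _).trans (add_le_add ((norm_add_le _ _).trans (add_le_add (hφb t) ?_))
        h1)
      exact (_root_.norm_sub_le _ _).trans (add_le_add (hR.norm_apply_le _ _) le_rfl)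
    refine ⟨⟨BoundedContinuousFunction.ofNormedAddCommGroup (Φ u) hc _ hbd, hl, fun t ht => ?_⟩,
      fun t => rfl⟩
    have h0 : τ t = 0 := by simp only [τ]; rw [projIcc_of_le_left hT0.le ht]
    change Φ u t = φ t
    simp only [Φ, h0, hR.eq_of_nonpos 0 le_rfl, semigroupConv, intervalIntegral.integral_same]
    simp
  choose Ψ hΨ using hex
  have hS : IsClosed S := by
    have he : ∀ t : ℝ, Continuous fun u : BoundedContinuousFunction ℝ E => u t := fun t =>
      continuous_eval_const t
    simp only [S, ofPred_and, ofPred_forall]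
    refine IsClosed.inter (isClosed_iInter fun s => isClosed_iInter fun t => ?_)
      (isClosed_iInter fun t => isClosed_iInter fun _ => ?_)
    · exact isClosed_le ((he s).sub (he t)).norm continuous_const
    · exact isClosed_eq (he t) continuous_const
  have : CompleteSpace S := hS.completeSpace_coe
  have hcontr : ContractingWith (1 / 2) Ψ := by
    refine ⟨by norm_num, LipschitzWith.of_dist_le_mul fun u v => ?_⟩
    rw [Subtype.dist_eq, Subtype.dist_eq, BoundedContinuousFunction.dist_le (by positivity)]
    intro t
    set D := dist (u : BoundedContinuousFunction ℝ E) v with hD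
    have hD0 : 0 ≤ D := dist_nonneg
    have h1 := hR.norm_semigroupConv_sub_le (hfc u) (hfc v) (hτ t).1 (D := N * D)
      (fun s _ => norm_delayTerm_historyOf_sub_le hB hr hK u.1.continuous v.1.continuous u.2.1 hD0
        (fun θ _ => by
          rw [← dist_eq_norm]; exact BoundedContinuousFunction.dist_coe_le_dist _))
    rw [hΨ, hΨ, dist_eq_norm]
    simp only [Φ, add_sub_add_left_eq_sub]
    refine h1.trans ?_
    calc M * (N * D) * τ t ≤ M * (N * D) * T := by gcongr; exact (hτ t).2
      _ = M * N * T * D := by ring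
      _ ≤ 1 / 2 * D := by gcongr
      _ = _ := by norm_num
  have hφS : BoundedContinuousFunction.ofNormedAddCommGroup φ hφc _ hφb ∈ S := by
    refine ⟨fun s t => (hφ s t).trans ?_, fun t _ => rfl⟩
    gcongr
    have : 0 ≤ M * ‖y‖ + M * (b + 1) := by positivity
    linarith
  have : Nonempty S := ⟨⟨_, hφS⟩⟩
  obtain ⟨u, hu⟩ : ∃ u, Ψ u = u := ⟨hcontr.fixedPoint, hcontr.fixedPoint_isFixedPt⟩
  refine ⟨u, u.1.continuous, u.2.1, u.2.2, ⟨fun t ht => ?_⟩⟩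
  have h1 := hΨ u t
  have h0 : τ t = t := by simp only [τ]; rw [projIcc_of_mem hT0.le ht]
  rw [hu] at h1
  simp only [Φ, h0, hφ0 t ht.1] at h1
  rw [h1, u.2.2 0 le_rfl]
  simp only [f]
  abel

/-- Two mild solutions with the same history coincide, if one of them is Lipschitz and the time
interval is short. -/
theorem eq_of_isMildSolution (hR : LocalAnalyticSemigroup R δ M C) {h : ℝ} (hh : 0 < h)
    {B : E → E} {r : HistorySpace h E → Icc (0 : ℝ) h} {LB Lr : NNReal} (hB : LipschitzWith LB B)
    (hr : LipschitzWith Lr r) {T K : ℝ} (hK : 0 ≤ K)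
    (hsmall : M * (LB * (K * Lr + 1)) * T ≤ 1 / 2) {u v : ℝ → E} (hu : Continuous u)
    (hv : Continuous v) (hul : ∀ s t, ‖u s - u t‖ ≤ K * |s - t|)
    (huv : ∀ t ∈ Icc (-h) 0, u t = v t) (hmu : IsMildSolution R (delayTerm B r) T u hu)
    (hmv : IsMildSolution R (delayTerm B r) T v hv) {t : ℝ} (ht : t ∈ Icc (-h) T) :
    u t = v t := by
  obtain ⟨s, hs, hmax⟩ := (isCompact_Icc (a := -h) (b := T)).exists_isMaxOn ⟨t, ht⟩
    (hu.sub hv).norm.continuousOn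
  have hle : ∀ a ∈ Icc (-h) T, ‖u a - v a‖ ≤ ‖u s - v s‖ := fun a ha => hmax ha
  suffices hz : ‖u s - v s‖ = 0 by
    have := hle t ht
    rw [hz] at this
    exact sub_eq_zero.1 (norm_le_zero_iff.1 this)
  rcases le_total s 0 with h0 | h0
  · rw [huv s ⟨hs.1, h0⟩, sub_self, norm_zero]
  · have hM := hR.bound_nonneg
    have hfc : ∀ (w : ℝ → E) (hw : Continuous w),
        Continuous fun s => delayTerm B r (historyOf w hw s) := fun w hw =>
      (continuous_delayTerm hB.continuous hr.continuous).comp (continuous_historyOf _ _)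
    have h1 := hR.norm_semigroupConv_sub_le (hfc u hu) (hfc v hv) h0
      (fun a ha => norm_delayTerm_historyOf_sub_le hB hr hK hu hv hul
        (norm_nonneg (u s - v s)) (fun θ hθ => hle (a + θ)
          ⟨by linarith [ha.1, hθ.1], by linarith [ha.2, hθ.2, hs.2]⟩))
    have h2 : u s - v s = semigroupConv R (fun s => delayTerm B r (historyOf u hu s)) s
        - semigroupConv R (fun s => delayTerm B r (historyOf v hv s)) s := by
      have e1 := hmu.eq_conv s ⟨h0, hs.2⟩
      have e2 := hmv.eq_conv s ⟨h0, hs.2⟩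
      rw [huv 0 ⟨by linarith, le_rfl⟩] at e1
      rw [e1, e2]
      abel
    rw [← h2] at h1
    have h3 : M * (LB * (K * Lr + 1) * ‖u s - v s‖) * s ≤ 1 / 2 * ‖u s - v s‖ := by
      calc M * (LB * (K * Lr + 1) * ‖u s - v s‖) * s
          ≤ M * (LB * (K * Lr + 1) * ‖u s - v s‖) * T := by gcongr; exact hs.2
        _ = M * (LB * (K * Lr + 1)) * T * ‖u s - v s‖ := by ring
        _ ≤ _ := by gcongr
    linarith [norm_nonneg (u s - v s)]

end LocalAnalyticSemigroup

end Mild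

/-! ### Classical solutions of the delay equation -/

section Classical

variable {𝕜 : Type*} [RCLike 𝕜] {E : Type*} [NormedAddCommGroup E]

theorem history_eq_historyOf {h T : ℝ} {u w : ℝ → E} (hu : ContinuousOn u (Ico (-h) T))
    (hw : Continuous w) {t : ℝ} (ht : t ∈ Ico 0 T) (huw : ∀ s ∈ Icc (-h) t, u s = w s) :
    history hu ht = historyOf w hw t := by
  ext θ
  exact huw (t + θ) ⟨by linarith [θ.2.1, ht.1], by linarith [θ.2.2]⟩

namespace LocalAnalyticSemigroup

variable [NormedSpace 𝕜 E] [NormedSpace ℝ E] [CompleteSpace E] {R : ℝ → E →L[ℝ] E} {δ M C : ℝ}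
  {A : E →ₗ.[𝕜] E}

/-- A Lipschitz mild solution is a classical solution: along it, the delay term is Lipschitz in
time. -/
theorem isClassicalSolution_of_isMildSolution (hR : LocalAnalyticSemigroup R δ M C)
    (hA : ∀ x y : E, (∃ hx : x ∈ A.domain, -A ⟨x, hx⟩ = y) ↔ HasGeneratorValue R x y)
    {h : ℝ} (hh : 0 < h) {B : E → E} {r : HistorySpace h E → Icc (0 : ℝ) h} {LB Lr : NNReal}
    (hB : LipschitzWith LB B) (hr : LipschitzWith Lr r) {φ : ℝ → E} (hφ0 : φ 0 ∈ A.domain)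
    {T K : ℝ} (hTδ : T ≤ δ) (hK : 0 ≤ K) {u : ℝ → E} (hu : Continuous u)
    (hul : ∀ s t, ‖u s - u t‖ ≤ K * |s - t|) (huφ : ∀ t ∈ Icc (-h) 0, u t = φ t)
    (hmu : IsMildSolution R (delayTerm B r) T u hu) :
    IsClassicalSolution A (delayTerm B r) φ T u := by
  set f : ℝ → E := fun s => delayTerm B r (historyOf u hu s) with hf
  have hfc : Continuous f :=
    (continuous_delayTerm hB.continuous hr.continuous).comp (continuous_historyOf _ _)
  have hfl : ∀ s t, ‖f s - f t‖ ≤ LB * (K * Lr + 1) * K * |s - t| := by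
    intro s t
    have := norm_delayTerm_historyOf_sub_le hB hr hK hu hu hul
      (s := s) (t := t) (D := K * |s - t|) (by positivity)
      (fun θ _ => by simpa using hul (s + θ) (t + θ))
    rwa [← mul_assoc] at this
  have hu0 : u 0 = φ 0 := huφ 0 ⟨by linarith, le_rfl⟩
  have hy : HasGeneratorValue R (u 0) (-A ⟨φ 0, hφ0⟩) := by
    rw [hu0]
    exact (hA _ _).1 ⟨hφ0, rfl⟩
  set v := fun t => R t (-A ⟨φ 0, hφ0⟩) + semigroupConvDeriv R f t with hv
  have hIoo : ∀ t ∈ Ioo 0 T, t ∈ Ioo 0 δ := fun t ht => ⟨ht.1, ht.2.trans_le hTδ⟩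
  have hd : ∀ t ∈ Ioo 0 T, HasDerivAt u (v t) t := by
    intro t ht
    refine (hR.hasDerivAt_mild hfl hfc hy (hIoo t ht)).congr_of_eventuallyEq ?_
    filter_upwards [Ioo_mem_nhds ht.1 ht.2] with s hs
    exact hmu.eq_conv s (Ioo_subset_Icc_self hs)
  have hg : ∀ t ∈ Ioo 0 T, HasGeneratorValue R (u t) (v t - f t) := by
    intro t ht
    rw [hmu.eq_conv t (Ioo_subset_Icc_self ht)]
    exact hR.hasGeneratorValue_mild hfl hfc hy (hIoo t ht)
  have hvc : ContinuousOn v (Ioo 0 T) := fun t ht =>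
    ((hR.continuous _).continuousAt.add (hR.continuousAt_semigroupConvDeriv hfl hfc ht.1
      (ht.2.trans_le hTδ))).continuousWithinAt
  refine
    { continuousOn := hu.continuousOn
      contDiffOn := ?_
      initial := huφ
      mem_domain := fun t ht => ((hA _ _).2 (hg t ht)).1
      equation := fun t ht => ?_ }
  · rw [contDiffOn_one_iff_derivWithin isOpen_Ioo.uniqueDiffOn]
    refine ⟨fun t ht => (hd t ht).differentiableAt.differentiableWithinAt, hvc.congr fun t ht => ?_⟩
    rw [derivWithin_of_isOpen isOpen_Ioo ht, (hd t ht).deriv]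
  · obtain ⟨hx, hxe⟩ := (hA _ _).2 (hg t ht)
    rw [history_eq_historyOf hu.continuousOn hu _ fun s _ => rfl, (hd t ht).deriv,
      neg_eq_iff_eq_neg.1 hxe]
    simp [f]

/-- The restriction of a classical solution to a compact interval `[-h, t]`, extended by constants,
is a mild solution. -/
theorem isMildSolution_of_isClassicalSolution (hR : LocalAnalyticSemigroup R δ M C)
    (hA : ∀ x y : E, (∃ hx : x ∈ A.domain, -A ⟨x, hx⟩ = y) ↔ HasGeneratorValue R x y)
    {h : ℝ} {F : HistorySpace h E → E} (hF : Continuous F) {φ : ℝ → E}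
    {T : ℝ} (hTδ : T ≤ δ) {v : ℝ → E} (hv : IsClassicalSolution A F φ T v) {t : ℝ}
    (ht0 : -h ≤ 0) (htT : t < T) {w : ℝ → E} (hw : Continuous w)
    (hvw : ∀ s ∈ Icc (-h) t, v s = w s) : IsMildSolution R F t w hw := by
  refine ⟨fun s hs => ?_⟩
  have hmem : ∀ a ∈ Icc 0 s, a ∈ Icc (-h) t := fun a ha =>
    ⟨ht0.trans ha.1, ha.2.trans hs.2⟩
  rw [← hvw s (hmem s ⟨hs.1, le_rfl⟩), ← hvw 0 (hmem 0 ⟨le_rfl, hs.1⟩)]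
  have hIoo : ∀ a ∈ Ioo 0 s, a ∈ Ioo 0 T := fun a ha =>
    ⟨ha.1, ha.2.trans_le (hs.2.trans htT.le)⟩
  refine hR.eq_mild_of_hasDerivAt (v' := deriv v) hs.1 (hs.2.trans (htT.le.trans hTδ))
    (hv.continuousOn.mono fun a ha => ⟨ht0.trans ha.1, ha.2.trans_lt (hs.2.trans_lt htT)⟩)
    (hF.comp (continuous_historyOf w hw)) (fun a ha => ?_) (fun a ha => ?_)
  · exact ((hv.contDiffOn.differentiableOn one_ne_zero).differentiableAt
      (isOpen_Ioo.mem_nhds (hIoo a ha))).hasDerivAt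
  · refine (hA _ _).1 ⟨hv.mem_domain a (hIoo a ha), ?_⟩
    have h1 := hv.equation a (hIoo a ha)
    rw [history_eq_historyOf hv.continuousOn hw _ fun b hb =>
      hvw b ⟨hb.1, hb.2.trans (ha.2.le.trans hs.2)⟩] at h1
    rw [← h1]
    abel

/-- Local existence and uniqueness of classical solutions: the Lipschitz mild solution is classical,
and every classical solution is mild, hence equal to it. -/
theorem exists_unique_isClassicalSolution (hR : LocalAnalyticSemigroup R δ M C)
    (hA : ∀ x y : E, (∃ hx : x ∈ A.domain, -A ⟨x, hx⟩ = y) ↔ HasGeneratorValue R x y)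
    {h : ℝ} (hh : 0 < h) {B : E → E} {r : HistorySpace h E → Icc (0 : ℝ) h} {LB Lr : NNReal}
    (hB : LipschitzWith LB B) (hr : LipschitzWith Lr r) {φ : ℝ → E} {Lφ : NNReal}
    (hφ : LipschitzOnWith Lφ φ (Icc (-h) 0)) (hφ0 : φ 0 ∈ A.domain) :
    ∃ T : ℝ, 0 < T ∧ ∃ u : ℝ → E, IsClassicalSolution A (delayTerm B r) φ T u ∧
      ∀ v : ℝ → E, IsClassicalSolution A (delayTerm B r) φ T v → EqOn v u (Ico (-h) T) := by
  have hh' : -h ≤ 0 := by linarith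
  let p : ℝ → ℝ := fun t => (projIcc (-h) 0 hh' t : ℝ)
  have hp : ∀ t, p t ∈ Icc (-h) 0 := fun t => (projIcc (-h) 0 hh' t).2
  have hp' : ∀ t ∈ Icc (-h) 0, p t = t := fun t ht => by
    simp only [p]; rw [projIcc_of_mem hh' ht]
  have hp0 : ∀ t, 0 ≤ t → p t = 0 := fun t ht => by
    simp only [p]; rw [projIcc_of_right_le hh' ht]
  have hl : ∀ s t, ‖φ (p s) - φ (p t)‖ ≤ Lφ * |s - t| := by
    intro s t
    have h1 := hφ.dist_le_mul _ (hp s) _ (hp t)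
    rw [dist_eq_norm] at h1
    refine h1.trans ?_
    gcongr
    simpa [Subtype.dist_eq, Real.dist_eq] using (LipschitzWith.projIcc hh').dist_le_mul s t
  obtain ⟨b, hb⟩ := isCompact_Icc.exists_bound_of_continuousOn hφ.continuousOn
  have hy : HasGeneratorValue R (φ (p 0)) (-A ⟨φ 0, hφ0⟩) := by
    rw [hp0 0 le_rfl]
    exact (hA _ _).1 ⟨hφ0, rfl⟩
  obtain ⟨T, K, hT, hTδ, hK, hsmall, u, hu, hul, hu0, hmu⟩ := hR.exists_isMildSolution hB hr
    (φ := fun t => φ (p t)) hl (fun t => hb _ (hp t))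
    (fun t ht => by simp only [hp0 t ht, hp0 0 le_rfl]) hy
  have huφ : ∀ t ∈ Icc (-h) 0, u t = φ t := fun t ht => by
    rw [hu0 t ht.2]; simp only [hp' t ht]
  refine ⟨T, hT, u, hR.isClassicalSolution_of_isMildSolution hA hh hB hr hφ0 hTδ.le hK hu hul
    huφ hmu, fun v hv t ht => ?_⟩
  rcases le_total t 0 with h0 | h0
  · rw [hv.initial ⟨ht.1, h0⟩, huφ t ⟨ht.1, h0⟩]
  have hht : -h ≤ t := ht.1
  let w : ℝ → E := fun s => v (projIcc (-h) t hht s)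
  have hvw : ∀ s ∈ Icc (-h) t, v s = w s := fun s hs => by
    simp only [w]; rw [projIcc_of_mem hht hs]
  have hw : Continuous w :=
    (hv.continuousOn.mono (Icc_subset_Ico_right ht.2)).comp_continuous
      (continuous_subtype_val.comp continuous_projIcc) fun s => (projIcc (-h) t hht s).2
  have hmw := hR.isMildSolution_of_isClassicalSolution hA
    (continuous_delayTerm hB.continuous hr.continuous) hTδ.le hv hh' ht.2 hw hvw
  have hmu' : IsMildSolution R (delayTerm B r) t u hu :=
    ⟨fun s hs => hmu.eq_conv s ⟨hs.1, hs.2.trans ht.2.le⟩⟩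
  have hM := hR.bound_nonneg
  have hsmall' : M * (LB * (K * Lr + 1)) * t ≤ 1 / 2 := by
    refine le_trans ?_ hsmall
    gcongr
    exact ht.2.le
  rw [hvw t ⟨ht.1, le_rfl⟩]
  refine (hR.eq_of_isMildSolution hh hB hr hK hsmall' hu hw hul (fun s hs => ?_) hmu' hmw
    ⟨ht.1, le_rfl⟩).symm
  rw [← hvw s ⟨hs.1, hs.2.trans h0⟩, hv.initial hs, huφ s hs]

end LocalAnalyticSemigroup

end Classical

/-! ### Local bounds for strongly continuous and analytic semigroups -/

section Bounds

/-- By the uniform boundedness principle, a strongly convergent family of operators is eventually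
bounded. -/
theorem exists_eventually_norm_le {𝕜 : Type*} [RCLike 𝕜] {E F α : Type*} [NormedAddCommGroup E]
    [NormedSpace 𝕜 E] [CompleteSpace E] [NormedAddCommGroup F] [NormedSpace 𝕜 F]
    {Z : α → E →L[𝕜] F} {l : Filter α} [l.IsCountablyGenerated]
    (h : ∀ x, ∃ y, Tendsto (fun a => Z a x) l (𝓝 y)) : ∃ M, ∀ᶠ a in l, ‖Z a‖ ≤ M := by
  by_contra! hcon
  obtain ⟨s, hs⟩ := l.exists_antitone_basis
  have hex : ∀ n : ℕ, ∃ a ∈ s n, (n : ℝ) < ‖Z a‖ := fun n => by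
    obtain ⟨a, h1, h2⟩ := ((hcon n).and_eventually (hs.mem n)).exists
    exact ⟨a, h2, by simpa using h1⟩
  choose a ha hZ using hex
  have hal : Tendsto a atTop l := hs.tendsto ha
  obtain ⟨M, hM⟩ := banach_steinhaus (g := fun n => Z (a n)) fun x => by
    obtain ⟨y, hy⟩ := h x
    obtain ⟨b, hb⟩ := ((hy.comp hal).norm).bddAbove_range
    exact ⟨b, fun n => hb ⟨n, rfl⟩⟩
  obtain ⟨n, hn⟩ := exists_nat_gt M
  linarith [hM n, hZ n]

section C0

variable {𝕜 : Type*} [RCLike 𝕜] {E : Type*} [NormedAddCommGroup E] [NormedSpace 𝕜 E]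
  {S : ℝ → E →L[𝕜] E}

theorem IsC0Semigroup.tendsto_nhdsGE (hS : IsC0Semigroup S) (x : E) :
    Tendsto (fun t : ℝ => S t x) (𝓝[≥] 0) (𝓝 x) := by
  rw [← Ioi_insert, nhdsWithin_insert, tendsto_sup]
  refine ⟨?_, hS.tendsto_zero x⟩
  rw [tendsto_pure_left]
  intro s hs
  simpa [hS.map_zero] using mem_of_mem_nhds hs

theorem IsC0Semigroup.exists_norm_le [CompleteSpace E] (hS : IsC0Semigroup S) :
    ∃ δ M : ℝ, 0 < δ ∧ ∀ t ∈ Icc 0 δ, ‖S t‖ ≤ M := by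
  obtain ⟨M, hM⟩ := exists_eventually_norm_le (l := 𝓝[≥] (0 : ℝ)) (Z := S)
    fun x => ⟨x, hS.tendsto_nhdsGE x⟩
  obtain ⟨δ, hδ, hsub⟩ := mem_nhdsGE_iff_exists_Icc_subset.1 hM
  exact ⟨δ, M, hδ, hsub⟩

theorem IsC0Semigroup.continuousOn_Icc (hS : IsC0Semigroup S) {δ M : ℝ}
    (hM : ∀ t ∈ Icc 0 δ, ‖S t‖ ≤ M) (x : E) : ContinuousOn (fun t => S t x) (Icc 0 δ) := by
  have key : ∀ s ∈ Icc 0 δ, ∀ t ∈ Icc 0 δ, s ≤ t →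
      ‖S t x - S s x‖ ≤ M * ‖S |t - s| x - x‖ := by
    intro s hs t _ hst
    have h1 := hS.map_add s (t - s) hs.1 (sub_nonneg.2 hst)
    rw [add_sub_cancel] at h1
    rw [h1, abs_of_nonneg (sub_nonneg.2 hst), ContinuousLinearMap.comp_apply, ← map_sub]
    exact (S s).le_of_opNorm_le (hM s hs) _
  intro s hs
  rw [ContinuousWithinAt, tendsto_iff_norm_sub_tendsto_zero]
  refine squeeze_zero' (g := fun t => M * ‖S |t - s| x - x‖)
    (Eventually.of_forall fun _ => norm_nonneg _) ?_ ?_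
  · filter_upwards [self_mem_nhdsWithin] with t ht
    rcases le_total s t with hst | hst
    · exact key s hs t ht hst
    · rw [norm_sub_rev, abs_sub_comm]
      exact key t ht s hs hst
  · have h1 : Tendsto (fun t : ℝ => |t - s|) (𝓝[Icc 0 δ] s) (𝓝[≥] 0) := by
      refine tendsto_nhdsWithin_iff.2 ⟨tendsto_nhdsWithin_of_tendsto_nhds ?_,
        Eventually.of_forall fun _ => mem_Ici.2 (abs_nonneg _)⟩
      exact Continuous.tendsto' (by fun_prop) _ _ (by simp)
    have h2 := (tendsto_iff_norm_sub_tendsto_zero.1 ((hS.tendsto_nhdsGE x).comp h1)).const_mul M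
    simpa using h2

end C0

theorem exists_ball_subset_openSector {θ : ℝ} (hθ : 0 < θ) :
    ∃ c : ℝ, 0 < c ∧ c ≤ 1 ∧ ∀ σ : ℝ, 0 < σ → Metric.ball (σ : ℂ) (c * σ) ⊆ openSector θ := by
  have h1 : ∀ᶠ z : ℂ in 𝓝 1, z ≠ 0 ∧ |Complex.arg z| < θ := by
    refine (eventually_ne_nhds one_ne_zero).and ?_
    have hc : ContinuousAt (fun z => |Complex.arg z|) 1 :=
      (Complex.continuousAt_arg Complex.one_mem_slitPlane).abs
    exact hc.eventually_lt continuousAt_const (by simpa using hθ)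
  obtain ⟨c, hc, hsub⟩ := Metric.eventually_nhds_iff_ball.1 h1
  refine ⟨min c 1, lt_min hc one_pos, min_le_right _ _, fun σ hσ z hz => ?_⟩
  have hσ' : (σ : ℂ) ≠ 0 := by exact_mod_cast hσ.ne'
  have hz' : z = (σ : ℂ) * (z / σ) := by field_simp
  have hw := hsub (z / σ) (by
    rw [Metric.mem_ball, dist_eq_norm] at hz ⊢
    have : z / σ - 1 = (z - σ) / σ := by field_simp
    rw [this, norm_div, Complex.norm_real, Real.norm_eq_abs, abs_of_pos hσ, div_lt_iff₀ hσ]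
    exact hz.trans_le (by gcongr; exact min_le_left _ _))
  refine ⟨fun h0 => hw.1 (by rw [h0, zero_div]), ?_⟩
  rw [hz', Complex.arg_real_mul _ hσ]
  exact hw.2

/-- The Cauchy estimate on discs of radius proportional to `σ` around `σ > 0`: a holomorphic
operator family on a sector that converges strongly at the vertex satisfies `‖Z'(σ)‖ ≤ C / σ` for
small `σ`. -/
theorem exists_norm_deriv_le_of_sector {F G : Type*} [NormedAddCommGroup F] [NormedSpace ℂ F]
    [CompleteSpace F] [NormedAddCommGroup G] [NormedSpace ℂ G] {θ : ℝ} (hθ : 0 < θ)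
    {Z : ℂ → F →L[ℂ] G} (hd : DifferentiableOn ℂ Z (openSector θ))
    (hlim : ∀ f, ∃ g, Tendsto (fun z => Z z f) (𝓝[openSector θ] 0) (𝓝 g)) :
    ∃ δ C : ℝ, 0 < δ ∧ ∀ σ : ℝ, 0 < σ → DifferentiableAt ℂ Z σ ∧
      (σ ≤ δ → ‖deriv Z σ‖ ≤ C / σ) := by
  obtain ⟨M, hM⟩ := exists_eventually_norm_le hlim
  obtain ⟨ρ, hρ, hsub⟩ := Metric.mem_nhdsWithin_iff.1 hM
  obtain ⟨c, hc, hc1, hball⟩ := exists_ball_subset_openSector hθ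
  refine ⟨ρ / 2, M * 2 / c, half_pos hρ, fun σ hσ => ⟨?_, fun hσδ => ?_⟩⟩
  · exact hd.differentiableAt
      (mem_of_superset (Metric.ball_mem_nhds _ (mul_pos hc hσ)) (hball σ hσ))
  · have hR : 0 < c * σ / 2 := by positivity
    have hcb : Metric.closedBall (σ : ℂ) (c * σ / 2) ⊆ Metric.ball (σ : ℂ) (c * σ) :=
      Metric.closedBall_subset_ball (by linarith)
    have := Complex.norm_deriv_le_of_forall_mem_sphere_norm_le (C := M) hR
      (hd.diffContOnCl_ball (hcb.trans (hball σ hσ))) fun z hz => by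
        have hz1 := hcb (Metric.sphere_subset_closedBall hz)
        refine hsub ⟨?_, hball σ hσ hz1⟩
        rw [mem_ball_zero_iff]
        rw [Metric.mem_ball, dist_eq_norm] at hz1
        calc ‖z‖ ≤ ‖z - σ‖ + ‖(σ : ℂ)‖ := by simpa using norm_add_le (z - σ) (σ : ℂ)
          _ < c * σ + σ := by
              rw [Complex.norm_real, Real.norm_eq_abs, abs_of_pos hσ]
              gcongr
          _ ≤ 1 * σ + σ := by gcongr
          _ ≤ ρ := by linarith
    refine this.trans (le_of_eq ?_)
    field_simp

end Bounds

/-! ### Transfer from the complexification -/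

section Transfer

variable {𝕜 : Type*} [RCLike 𝕜] {Ω : Type*} [MeasurableSpace Ω] {μ : Measure Ω}

theorem norm_rclikeMap_complex (z : 𝕜) : ‖RCLike.map 𝕜 ℂ z‖ = ‖z‖ := by
  rw [RCLike.map_apply, ← RCLike.sqrt_normSq_eq_norm (z := z), RCLike.normSq_apply]
  simp [Complex.norm_add_mul_I, sq]

/-- `toComplexL2` as a real-linear isometry. -/
def toComplexL2Isometry : Lp 𝕜 2 μ →ₗᵢ[ℝ] Lp ℂ 2 μ where
  toLinearMap := (RCLike.map 𝕜 ℂ).compLpₗ 2 μ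
  norm_map' f := by
    have hn : ∀ᵐ a ∂μ, ‖(RCLike.map 𝕜 ℂ).compLp f a‖ = ‖f a‖ := by
      filter_upwards [(RCLike.map 𝕜 ℂ).coeFn_compLp f] with a ha
      rw [ha, norm_rclikeMap_complex]
    exact le_antisymm (Lp.norm_le_norm_of_ae_le (hn.mono fun a ha => ha.le))
      (Lp.norm_le_norm_of_ae_le (hn.mono fun a ha => ha.ge))

theorem toComplexL2Isometry_apply (f : Lp 𝕜 2 μ) : toComplexL2Isometry f = toComplexL2 f := rfl

/-- An isometry reflects differentiability of curves, since its range is closed. -/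
theorem LinearIsometry.differentiableAt_of_comp {E F : Type*} [NormedAddCommGroup E]
    [NormedSpace ℝ E] [CompleteSpace E] [NormedAddCommGroup F] [NormedSpace ℝ F]
    (ι : E →ₗᵢ[ℝ] F) {u : ℝ → E} {t : ℝ} (h : DifferentiableAt ℝ (fun s => ι (u s)) t) :
    DifferentiableAt ℝ u t := by
  have h0 := hasDerivAt_iff_tendsto_slope.1 h.hasDerivAt
  have h2 : ∀ s, slope (fun s => ι (u s)) t s = ι (slope u t s) := fun s => by
    simp [slope]
  have h1 := h0.congr h2
  obtain ⟨y, hy⟩ := ι.isometry.isClosedEmbedding.isClosed_range.mem_of_tendsto h1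
    (Eventually.of_forall fun s => mem_range_self _)
  rw [← hy] at h1
  exact (hasDerivAt_iff_tendsto_slope.2
    (ι.isometry.isEmbedding.tendsto_nhds_iff.2 h1)).differentiableAt

theorem IsAnalyticSemigroup.exists_norm_sub_le {S : ℝ → Lp 𝕜 2 μ →L[𝕜] Lp 𝕜 2 μ}
    (hS : IsAnalyticSemigroup S) :
    ∃ δ C : ℝ, 0 < δ ∧ (∀ σ : ℝ, 0 < σ → ∀ x, DifferentiableAt ℝ (fun t => S t x) σ) ∧
      ∀ σ η : ℝ, 0 < σ → 0 ≤ η → σ + η ≤ δ → ∀ x, ‖S (σ + η) x - S σ x‖ ≤ C * η / σ * ‖x‖ := by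
  obtain ⟨θ, hθ, -, Z, hZS, hd, -, hlim⟩ := hS
  obtain ⟨δ, C, hδ, hZ⟩ := exists_norm_deriv_le_of_sector hθ hd fun f => ⟨f, hlim f⟩
  have hder : ∀ σ : ℝ, 0 < σ → HasDerivAt (fun t : ℝ => Z t) (deriv Z σ) σ := fun σ hσ => by
    have h1 := (hZ σ hσ).1.hasDerivAt.scomp σ Complex.ofRealCLM.hasDerivAt
    rw [Complex.ofRealCLM_apply, Complex.ofReal_one, one_smul] at h1
    exact h1
  refine ⟨δ, C, hδ, fun σ hσ x => ?_, fun σ η hσ hη hle x => ?_⟩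
  · refine toComplexL2Isometry.differentiableAt_of_comp ?_
    have h1 : DifferentiableAt ℝ (fun t : ℝ => Z t (toComplexL2 x)) σ :=
      DifferentiableAt.comp (g := fun T : Lp ℂ 2 μ →L[ℂ] Lp ℂ 2 μ => T (toComplexL2 x)) σ
        ((ContinuousLinearMap.apply ℂ (Lp ℂ 2 μ) (toComplexL2 x)).restrictScalars
          ℝ).differentiableAt (hder σ hσ).differentiableAt
    refine h1.congr_of_eventuallyEq ?_
    filter_upwards [Ioi_mem_nhds hσ] with t ht
    rw [toComplexL2Isometry_apply, hZS t ht]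
  · rw [← toComplexL2Isometry.norm_map, map_sub, toComplexL2Isometry_apply,
      toComplexL2Isometry_apply, ← hZS _ hσ, ← hZS _ (by linarith),
      ← _root_.sub_apply, ← toComplexL2Isometry.norm_map x,
      toComplexL2Isometry_apply]
    refine ContinuousLinearMap.le_of_opNorm_le _ ?_ _
    have h2 := norm_image_sub_le_of_norm_deriv_le_segment' (f := fun t : ℝ => Z t)
      (f' := fun t : ℝ => deriv Z t) (a := σ) (b := σ + η) (C := C / σ)
      (fun t ht => (hder t (hσ.trans_le ht.1)).hasDerivWithinAt) (fun t ht => ?_) (σ + η)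
      ⟨by linarith, le_rfl⟩
    · refine h2.trans (le_of_eq ?_)
      ring
    · have ht0 : 0 < t := hσ.trans_le ht.1
      have hb := (hZ t ht0).2 (ht.2.le.trans hle)
      have hC : 0 ≤ C := by
        have := (norm_nonneg _).trans hb
        by_contra! hneg
        linarith [div_neg_of_neg_of_pos hneg ht0]
      refine hb.trans ?_
      gcongr
      exact ht.1

/-- An analytic `C₀`-semigroup, restricted to a short time interval. -/
theorem exists_localAnalyticSemigroup {S : ℝ → Lp 𝕜 2 μ →L[𝕜] Lp 𝕜 2 μ} (hS : IsC0Semigroup S)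
    (hSa : IsAnalyticSemigroup S) :
    ∃ (R : ℝ → Lp 𝕜 2 μ →L[ℝ] Lp 𝕜 2 μ) (δ M C : ℝ), LocalAnalyticSemigroup R δ M C ∧
      ∀ t ∈ Icc 0 δ, ∀ x, R t x = S t x := by
  obtain ⟨δ₁, M, hδ₁, hM⟩ := hS.exists_norm_le
  obtain ⟨δ₂, C, hδ₂, hdiff, hsub⟩ := hSa.exists_norm_sub_le
  set δ := min δ₁ δ₂ with hδdef
  have hδ : 0 < δ := lt_min hδ₁ hδ₂
  have hMδ : ∀ t ∈ Icc 0 δ, ‖S t‖ ≤ M := fun t ht =>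
    hM t ⟨ht.1, ht.2.trans (min_le_left _ _)⟩
  let R : ℝ → Lp 𝕜 2 μ →L[ℝ] Lp 𝕜 2 μ := fun t =>
    (S (projIcc 0 δ hδ.le t)).restrictScalars ℝ
  have hRS : ∀ t ∈ Icc 0 δ, ∀ x, R t x = S t x := fun t ht x => by
    simp only [R, ContinuousLinearMap.coe_restrictScalars']
    rw [projIcc_of_mem hδ.le ht]
  refine ⟨R, δ, M, C, ?_, hRS⟩
  refine
    { delta_pos := hδ
      eq_of_nonpos := fun t ht x => ?_
      map_add := fun s t hs ht hst x => ?_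
      continuous := fun x => ?_
      norm_le := fun t => ?_
      norm_sub_le := fun σ η hσ hη hle x => ?_
      differentiableAt := fun σ h0 h1 x => ?_ }
  · simp only [R, ContinuousLinearMap.coe_restrictScalars']
    rw [projIcc_of_le_left hδ.le ht]
    simp [hS.map_zero]
  · rw [hRS _ ⟨by linarith, hst⟩, hRS _ ⟨hs, by linarith⟩, hRS _ ⟨ht, by linarith⟩,
      hS.map_add s t hs ht]
    rfl
  · exact (hS.continuousOn_Icc hMδ x).comp_continuous
      (continuous_subtype_val.comp continuous_projIcc) fun t => (projIcc 0 δ hδ.le t).2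
  · simp only [R, ContinuousLinearMap.norm_restrictScalars]
    exact hMδ _ (projIcc 0 δ hδ.le t).2
  · rw [hRS _ ⟨by linarith, hle⟩, hRS _ ⟨hσ.le, by linarith⟩]
    exact hsub σ η hσ hη (hle.trans (min_le_right _ _)) x
  · refine (hdiff σ h0 x).congr_of_eventuallyEq ?_
    filter_upwards [Ioo_mem_nhds h0 h1] with t ht using hRS t (Ioo_subset_Icc_self ht) x

end Transfer

end

theorem theorem2 {𝕜 : Type*} [RCLike 𝕜] {Ω : Type*} [MeasurableSpace Ω] (μ : Measure Ω)
    (h : ℝ) (hh : 0 < h)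
    (A : Lp 𝕜 2 μ →ₗ.[𝕜] Lp 𝕜 2 μ) (hA : GeneratesCompactAnalyticSemigroup A)
    (B : Lp 𝕜 2 μ → Lp 𝕜 2 μ)
    (hB_bdd : ∀ s : Set (Lp 𝕜 2 μ), Bornology.IsBounded s → Bornology.IsBounded (B '' s))
    (hB_lip : ∃ L, LipschitzWith L B)
    (r : HistorySpace h (Lp 𝕜 2 μ) → Icc (0 : ℝ) h) (hr : ∃ L, LipschitzWith L r)
    (φ : ℝ → Lp 𝕜 2 μ) (hφ : ContDiffOn ℝ 1 φ (Icc (-h) 0)) (hφ0 : φ 0 ∈ A.domain) :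
    ∃ tφ : ℝ, 0 < tφ ∧ ∃ u : ℝ → Lp 𝕜 2 μ,
      IsClassicalSolution A (delayTerm B r) φ tφ u ∧
      ∀ v : ℝ → Lp 𝕜 2 μ, IsClassicalSolution A (delayTerm B r) φ tφ v →
        EqOn v u (Ico (-h) tφ) := by
  obtain ⟨S, hS, -, hSa, hgen⟩ := hA
  obtain ⟨LB, hB⟩ := hB_lip
  obtain ⟨Lr, hr⟩ := hr
  obtain ⟨R, δ, M, C, hR, hRS⟩ := exists_localAnalyticSemigroup hS hSa
  obtain ⟨Lφ, hφl⟩ := hφ.exists_lipschitzOnWith one_ne_zero (convex_Icc _ _) isCompact_Icc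
  refine hR.exists_unique_isClassicalSolution (fun x y => ?_) hh hB hr hφl hφ0
  refine (hgen x y).trans (tendsto_congr' ?_)
  filter_upwards [Ioo_mem_nhdsGT hR.delta_pos] with t ht
  rw [hRS t (Ioo_subset_Icc_self ht), RCLike.real_smul_eq_coe_smul (K := 𝕜)]
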